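/- Let $d\in\mathbb N$ and let $\nu$ be a compactly supported Borel probability measure on $\mathbb R^d$ (with the Euclidean norm $|\cdot|$). For $n\in\mathbb N$ let $\mathcal D_n$ be the partition of $\mathbb R^d$ into the half-open cubes $\prod_{i=1}^d\bigl(k_i2^{-n},(k_i+1)2^{-n}\bigr]$, $k\in\mathbb Z^d$. For $q\ge 0$ the $L^q$-spectrum of $\nu$ is $$\beta_\nu(q)=\limsup_{n\to\infty}\frac{\log\sum_{C\in\mathcal D_n,\ \nu(C)>0}\nu(C)^q}{\log 2^n},$$ $\partial^-\beta_\nu(1)$ denotes its left-sided derivative at $1$, and for $q\ge0$, $q\ne1$, the upper Rényi dimension is $\overline{\mathfrak R}_\nu(q)=\beta_\nu(q)/(1-q)$. For $r>0$ the upper quantization dimension of order $r$ is $$\overline D_r(\nu)=\limsup_{n\to\infty}\frac{\log n}{-\log \mathfrak e_{n,r}(\nu)},\qquad \mathfrak e_{n,r}(\nu)=\inf_f\Bigl(\int|x-f(x)|^r\,d\nu(x)\Bigr)^{1/r},$$ where the infimum is over all Borel maps $f:\mathbb R^d\to\mathbb R^d$ taking at most $n$ values. For $A\subset\mathbb R^d$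 let $\overline{\dim}_M(A)=\limsup_{\delta\downarrow0}\log N_\delta(A)/(-\log\delta)$, with $N_\delta(A)$ the least number of closed $\delta$-balls covering $A$, be the upper Minkowski dimension, and put $\overline{\dim}_M(\nu)=\overline{\dim}_M(\operatorname{supp}\nu)$. Let $\dim_H$ and $\dim_P$ denote Hausdorff and packing dimension (for nonempty $A$, $\dim_P(A)=\inf\{\sup_j\overline{\dim}_M(S_j):A\subset\bigcup_{j\in\mathbb N}S_j\}$), and put $\dim_H(\nu)=\inf\{\dim_H(A):A\text{ Borel},\ \nu(A)>0\}$ and $\dim_P^*(\nu)=\inf\{\dim_P(A):A\text{ Borel},\ \nu(A)=1\}$. Assume $\overline{\dim}_M(\nu)>0$. Then the following are equivalent: 1. $\overline D_r(\nu)=\overline{\dim}_M(\nu)$ for some $r>0$; 2. $\overline{\mathfrak R}_\nu(q)=\overline{\dim}_M(\nu)$ for some $q\in(0,1)$; 3. $\partial^-\beta_\nu(1)$ exists and $\partial^-\beta_\nu(1)\le-\overline{\dim}_M(\nu)$; 4. $\beta_\nu$ is linear on $[0,1]$, i.e. $\beta_\nu(q)=\overline{\dim}_M(\nu)(1-q)$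 for all $q\in[0,1]$; 5. $\overline D_r(\nu)=\overline{\dim}_M(\nu)$ for all $r>0$. Moreover, if $\dim_P^*(\nu)=\overline{\dim}_M(\nu)$ or $\dim_H(\nu)=\overline{\dim}_M(\nu)$, then (3) holds. -/

import Mathlib

open MeasureTheory Filter Topology Set
open scoped ENNReal NNReal

noncomputable section

namespace QuantDim

/-- The half-open dyadic cube `∏ i, (k i * 2⁻ⁿ, (k i + 1) * 2⁻ⁿ]` of `ℝᵈ`. For fixed `n` and
varying `k ∈ ℤᵈ` these cubes form the partition `𝒟 n` of `ℝᵈ`. -/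
def dyadicCube {d : ℕ} (n : ℕ) (k : Fin d → ℤ) : Set (EuclideanSpace ℝ (Fin d)) :=
  {x | ∀ i, (k i : ℝ) * (2 : ℝ)⁻¹ ^ n < x i ∧ x i ≤ ((k i : ℝ) + 1) * (2 : ℝ)⁻¹ ^ n}

/-- The sum `∑_{C ∈ 𝒟 n} ν(C) ^ q`, where cubes with `ν(C) = 0` are neglected
(this is the convention `0 ^ 0 = 0`). -/
def dyadicPowerSum {d : ℕ} (ν : Measure (EuclideanSpace ℝ (Fin d))) (n : ℕ) (q : ℝ) : ℝ≥0∞ :=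
  ∑' k : Fin d → ℤ, if ν (dyadicCube n k) = 0 then 0 else ν (dyadicCube n k) ^ q

/-- The `L^q`-spectrum
`β_ν(q) = limsup_n log (∑_{C ∈ 𝒟 n} ν(C) ^ q) / log (2 ^ n)`, for `q ≥ 0`. -/
def lqSpectrum {d : ℕ} (ν : Measure (EuclideanSpace ℝ (Fin d))) (q : ℝ) : EReal :=
  limsup (fun n : ℕ => ENNReal.log (dyadicPowerSum ν n q) / ((Real.log (2 ^ n) : ℝ) : EReal)) atTop

/-- The upper generalized Rényi dimension of `ν`, for `q ≥ 0`. -/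
def upperRenyiDim {d : ℕ} (ν : Measure (EuclideanSpace ℝ (Fin d))) (q : ℝ) : EReal :=
  if q = 1 then
    limsup (fun n : ℕ =>
      (((∑' k : Fin d → ℤ,
          (ν (dyadicCube n k)).toReal * Real.log (ν (dyadicCube n k)).toReal)
        / Real.log ((2 ^ n : ℝ)⁻¹) : ℝ) : EReal)) atTop
  else lqSpectrum ν q / ((1 - q : ℝ) : EReal)

/-- The `n`-th quantization error of `ν` of order `r > 0`: the infimum of
`(∫ |x - f x| ^ r dν) ^ (1 / r)` over all Borel maps `f` with at most `n` values. -/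
def quantError {d : ℕ} (ν : Measure (EuclideanSpace ℝ (Fin d))) (n : ℕ) (r : ℝ) : ℝ≥0∞ :=
  ⨅ (f : EuclideanSpace ℝ (Fin d) → EuclideanSpace ℝ (Fin d))
    (_ : Measurable f ∧ (range f).encard ≤ n), (∫⁻ x, ‖x - f x‖ₑ ^ r ∂ν) ^ (1 / r)

/-- The upper quantization dimension of `ν` of order `r > 0`. -/
def upperQuantDim {d : ℕ} (ν : Measure (EuclideanSpace ℝ (Fin d))) (r : ℝ) : EReal :=
  limsup (fun n : ℕ => ((Real.log n : ℝ) : EReal) / (-ENNReal.log (quantError ν n r))) atTop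

/-- The upper Minkowski (box-counting) dimension of a set `A`,
`limsup_{δ ↓ 0} log N_δ(A) / (-log δ)`, where `N_δ(A)` is the least number of closed
`δ`-balls needed to cover `A`. -/
def upperMinkowskiDim {X : Type*} [PseudoEMetricSpace X] (A : Set X) : EReal :=
  limsup (fun δ : ℝ≥0 => ENNReal.log ((Metric.externalCoveringNumber δ A : ℕ∞) : ℝ≥0∞)
    / ((-Real.log (δ : ℝ) : ℝ) : EReal)) (𝓝[>] 0)

/-- The packing dimension of a (nonempty) set `A`, as the infimum over all countable covers
`A ⊆ ⋃ j, S j` of `sup_j` of the upper Minkowski dimension of `S j`. -/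
def packingDim {X : Type*} [PseudoEMetricSpace X] (A : Set X) : EReal :=
  ⨅ (S : ℕ → Set X) (_ : A ⊆ ⋃ j, S j), ⨆ j, upperMinkowskiDim (S j)

/-- `dim̄_M(ν)`, the upper Minkowski dimension of the support of `ν`. -/
def upperMinkowskiDimMeasure {d : ℕ} (ν : Measure (EuclideanSpace ℝ (Fin d))) : EReal :=
  upperMinkowskiDim ν.support

/-- `dim_H(ν)`, the infimum of the Hausdorff dimensions of Borel sets of positive measure. -/
def hausdorffDimMeasure {d : ℕ} (ν : Measure (EuclideanSpace ℝ (Fin d))) : EReal :=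
  ⨅ (A : Set (EuclideanSpace ℝ (Fin d))) (_ : MeasurableSet A ∧ 0 < ν A), ((dimH A : ℝ≥0∞) : EReal)

/-- `dim_P^*(ν)`, the infimum of the packing dimensions of Borel sets of full measure. -/
def packingDimStarMeasure {d : ℕ} (ν : Measure (EuclideanSpace ℝ (Fin d))) : EReal :=
  ⨅ (A : Set (EuclideanSpace ℝ (Fin d))) (_ : MeasurableSet A ∧ ν A = ν univ), packingDim A

/-- `∂⁻β_ν(1) ≤ c`: the left-sided derivative of the `L^q`-spectrum at `1` exists and is at
most `c`. -/
def LeftDerivAtOneLE {d : ℕ} (ν : Measure (EuclideanSpace ℝ (Fin d))) (c : EReal) : Prop :=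
  ∃ b : ℝ, HasDerivWithinAt (fun q : ℝ => (lqSpectrum ν q).toReal) b (Iic 1) 1 ∧ (b : EReal) ≤ c

end QuantDim

end

namespace QuantDim

/-! ### Exponential growth rates -/

/-! Write `β` for the spectrum and `D` for the upper Minkowski dimension of the support. By Hölder,
`β` is convex on `[0, 1]`; moreover `β(0) = D` (`lqSpectrum_zero`) and `β(1) = 0`. So `β` lies below
the chord `D (1 - q)`, and touching it at one interior point forces equality everywhere
(`eq_chord_of_convexOn`). Each condition says that `β` touches the chord. For the Rényi dimension
this is immediate; for the left derivative it follows from monotonicity of secant slopes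
(`chord_le_of_hasDerivWithinAt`).

Quantization, upper bound: if `β(q) < r q`, the cubes of weight `ν(C) 2^(-n r)` above a threshold
give a codebook showing that the dimension of order `r` is at most `r q / (1 - q)`
(`upperQuantDim_le`). The chord meets the line `r q` at `q₀ = D / (r + D)`, where this bound equals
`D`. If `β(q₀)` is below the chord, a slightly smaller `q` is also admissible and the dimension
drops below `D` (`exists_le_of_upperQuantDim_eq`).

Quantization, lower bound: if `β` touches the chord, then at infinitely many scales subexponentially
small mass `2^(-n η)` sits in cubes of mass at most `2^(-n (D - δ))`
(`frequently_le_measure_of_chord_le`). A codebook with far fewer than `2^(n D)` points misses half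
of it by `2^(-n)`, for every order `r`.

Dimensions of `ν`: if `β(q) < s (1 - q)`, Borel–Cantelli shows that almost every point eventually
lies in cubes of mass at least `2^(-n s)`. There are at most `2^(n s)` of these per level, so the
packing and Hausdorff dimensions of `ν` are at most `s` (`packingDimStarMeasure_le`,
`hausdorffDimMeasure_le`). -/

lemma two_rpow_ne_zero (x : ℝ) : (2 : ℝ≥0∞) ^ x ≠ 0 := by simp

lemma two_rpow_ne_top (x : ℝ) : (2 : ℝ≥0∞) ^ x ≠ ⊤ := by simp

lemma two_rpow_add (x y : ℝ) : (2 : ℝ≥0∞) ^ (x + y) = 2 ^ x * 2 ^ y :=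
  ENNReal.rpow_add _ _ (by norm_num) (by norm_num)

lemma two_rpow_le_two_rpow {x y : ℝ} (h : x ≤ y) : (2 : ℝ≥0∞) ^ x ≤ 2 ^ y :=
  ENNReal.rpow_le_rpow_of_exponent_le (by norm_num) h

lemma log_two_rpow (x : ℝ) : ENNReal.log ((2 : ℝ≥0∞) ^ x) = ((x * Real.log 2 : ℝ) : EReal) := by
  rw [ENNReal.log_rpow, ENNReal.log_pos_real (by norm_num) (by norm_num)]
  simp

lemma log_div_log_two_pow_le_iff {a : ℝ≥0∞} {n : ℕ} (hn : 0 < n) (u : ℝ) :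
    ENNReal.log a / ((Real.log (2 ^ n) : ℝ) : EReal) ≤ u ↔ a ≤ 2 ^ (n * u) := by
  have h : (0 : ℝ) < Real.log (2 ^ n) := Real.log_pos (one_lt_pow₀ (by norm_num) hn.ne')
  rw [EReal.div_le_iff_le_mul (by exact_mod_cast h) (EReal.coe_ne_top _), ← EReal.coe_mul,
    ← ENNReal.log_le_log_iff, log_two_rpow, Real.log_pow]
  ring_nf

lemma lt_log_div_log_two_pow_iff {a : ℝ≥0∞} {n : ℕ} (hn : 0 < n) (u : ℝ) :
    (u : EReal) < ENNReal.log a / ((Real.log (2 ^ n) : ℝ) : EReal) ↔ 2 ^ (n * u) < a := by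
  rw [← not_le, log_div_log_two_pow_le_iff hn, not_le]

/-- The exponential growth rate in base two of a sequence. -/
noncomputable def growthRate (a : ℕ → ℝ≥0∞) : EReal :=
  limsup (fun n : ℕ => ENNReal.log (a n) / ((Real.log (2 ^ n) : ℝ) : EReal)) atTop

lemma eventually_le_of_growthRate_lt {a : ℕ → ℝ≥0∞} {u : ℝ} (h : growthRate a < u) :
    ∀ᶠ n : ℕ in atTop, a n ≤ 2 ^ (n * u) := by
  filter_upwards [eventually_lt_of_limsup_lt h, eventually_gt_atTop 0] with n hn h0
  exact (log_div_log_two_pow_le_iff h0 u).1 hn.le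

lemma frequently_lt_of_lt_growthRate {a : ℕ → ℝ≥0∞} {u : ℝ} (h : (u : EReal) < growthRate a) :
    ∃ᶠ n : ℕ in atTop, 2 ^ (n * u) < a n := by
  refine ((frequently_lt_of_lt_limsup (by isBoundedDefault) h).and_eventually
    (eventually_gt_atTop 0)).mono fun n hn => ?_
  exact (lt_log_div_log_two_pow_iff hn.2 u).1 hn.1

lemma eventually_le_two_rpow {C : ℝ≥0∞} (hC : C ≠ ⊤) {η : ℝ} (hη : 0 < η) :
    ∀ᶠ n : ℕ in atTop, C ≤ 2 ^ (n * η) := by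
  have h : Tendsto (fun n : ℕ => ((2 : ℝ≥0∞) ^ η) ^ n) atTop (𝓝 ⊤) :=
    ENNReal.tendsto_pow_atTop_nhds_top_iff.2 (ENNReal.one_lt_rpow (by norm_num) hη)
  filter_upwards [h.eventually_const_lt hC.lt_top] with n hn
  rw [mul_comm, ENNReal.rpow_mul, ENNReal.rpow_natCast]
  exact hn.le

/-- A constant factor does not affect the rate: `2 ^ (n * (v - u))` absorbs it for every `v > u`. -/
lemma growthRate_le {a : ℕ → ℝ≥0∞} {C : ℝ≥0∞} (hC : C ≠ ⊤) {u : ℝ}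
    (h : ∀ᶠ n : ℕ in atTop, a n ≤ C * 2 ^ (n * u)) : growthRate a ≤ u := by
  refine EReal.le_of_forall_lt_iff_le.1 fun v hv => ?_
  have hv' : u < v := by exact_mod_cast hv
  refine limsup_le_of_le (by isBoundedDefault) ?_
  filter_upwards [h, eventually_le_two_rpow hC (sub_pos.2 hv'), eventually_gt_atTop 0]
    with n h1 h2 h3
  rw [log_div_log_two_pow_le_iff h3]
  calc a n ≤ C * 2 ^ (n * u) := h1
    _ ≤ 2 ^ (n * (v - u)) * 2 ^ (n * u) := by gcongr
    _ = 2 ^ (n * v) := by rw [← two_rpow_add]; ring_nf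

lemma le_growthRate {a : ℕ → ℝ≥0∞} {u : ℝ} (h : ∃ᶠ n : ℕ in atTop, 2 ^ (n * u) ≤ a n) :
    (u : EReal) ≤ growthRate a := by
  by_contra! hlt
  obtain ⟨v, hv, hvu⟩ := EReal.lt_iff_exists_real_btwn.1 hlt
  have hvu' : v < u := by exact_mod_cast hvu
  obtain ⟨n, ⟨h1, h2⟩, h3⟩ := ((h.and_eventually (eventually_le_of_growthRate_lt hv)).and_eventually
    (eventually_gt_atTop 0)).exists
  have h4 : (2 : ℝ≥0∞) ^ (n * v) < 2 ^ (n * u) :=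
    ENNReal.rpow_lt_rpow_of_exponent_lt (by norm_num) (by norm_num)
      (by have : (0:ℝ) < n := by exact_mod_cast h3
          gcongr)
  exact absurd (h1.trans h2) (not_le.2 h4)

/-! ### Geometry of dyadic cubes -/

variable {d : ℕ}

/-- The index of the level `n` dyadic cube containing `x`. -/
noncomputable def cubeIndex (n : ℕ) (x : EuclideanSpace ℝ (Fin d)) : Fin d → ℤ :=
  fun i => ⌈(2 : ℝ) ^ n * x i⌉ - 1

/-- The cubes contain their upper faces, so the index is a ceiling minus one rather than a floor. -/
lemma mem_dyadicCube_iff {n : ℕ} {k : Fin d → ℤ} {x : EuclideanSpace ℝ (Fin d)} :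
    x ∈ dyadicCube n k ↔ cubeIndex n x = k := by
  have h2 : (0 : ℝ) < 2 ^ n := by positivity
  rw [funext_iff]
  refine forall_congr' fun i => ?_
  have e : cubeIndex n x i = k i ↔ ⌈(2 : ℝ) ^ n * x i⌉ = k i + 1 := by
    unfold cubeIndex; omega
  rw [e, Int.ceil_eq_iff, inv_pow, ← div_eq_mul_inv, ← div_eq_mul_inv, div_lt_iff₀ h2,
    le_div_iff₀ h2]
  push_cast
  rw [mul_comm (x i), add_sub_cancel_right]

lemma mem_dyadicCube_cubeIndex (n : ℕ) (x : EuclideanSpace ℝ (Fin d)) :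
    x ∈ dyadicCube n (cubeIndex n x) := mem_dyadicCube_iff.2 rfl

lemma dyadicCube_eq_preimage (n : ℕ) (k : Fin d → ℤ) :
    (dyadicCube n k : Set (EuclideanSpace ℝ (Fin d))) = cubeIndex n ⁻¹' {k} := by
  ext x; exact mem_dyadicCube_iff

lemma measurable_cubeIndex (n : ℕ) :
    Measurable (cubeIndex n : EuclideanSpace ℝ (Fin d) → Fin d → ℤ) := by
  refine measurable_pi_lambda _ fun i => ?_
  unfold cubeIndex
  have : Measurable fun x : EuclideanSpace ℝ (Fin d) => (2 : ℝ) ^ n * x i := by fun_prop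
  exact (Int.measurable_ceil.comp this).sub_const 1

lemma measurableSet_dyadicCube (n : ℕ) (k : Fin d → ℤ) :
    MeasurableSet (dyadicCube n k : Set (EuclideanSpace ℝ (Fin d))) := by
  rw [dyadicCube_eq_preimage]
  exact measurable_cubeIndex n (measurableSet_singleton k)

/-- The upper corner of a dyadic cube. -/
noncomputable def cubeCorner (n : ℕ) (k : Fin d → ℤ) : EuclideanSpace ℝ (Fin d) :=
  WithLp.toLp 2 fun i => ((k i : ℝ) + 1) * (2 : ℝ)⁻¹ ^ n

lemma cubeCorner_mem (n : ℕ) (k : Fin d → ℤ) : cubeCorner n k ∈ dyadicCube n k := by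
  intro i
  have : (0 : ℝ) < (2 : ℝ)⁻¹ ^ n := by positivity
  simp only [cubeCorner]
  constructor
  · nlinarith
  · exact le_rfl

lemma two_rpow_neg_eq_ofReal (n : ℕ) : (2 : ℝ≥0∞) ^ (-(n : ℝ)) = ENNReal.ofReal ((2 : ℝ)⁻¹ ^ n) := by
  rw [ENNReal.rpow_neg, ENNReal.rpow_natCast, ENNReal.ofReal_pow (by norm_num),
    ENNReal.ofReal_inv_of_pos (by norm_num), ENNReal.inv_pow]
  norm_num

/-- The sharp constant is `√d`; the cruder `d` suffices because constants disappear in all rates. -/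
lemma edist_le_of_mem_dyadicCube {n : ℕ} {k : Fin d → ℤ} {x y : EuclideanSpace ℝ (Fin d)}
    (hx : x ∈ dyadicCube n k) (hy : y ∈ dyadicCube n k) :
    edist x y ≤ d * (2 : ℝ≥0∞) ^ (-(n : ℝ)) := by
  have h0 : (0 : ℝ) < (2 : ℝ)⁻¹ ^ n := by positivity
  have key : dist x y ≤ d * (2 : ℝ)⁻¹ ^ n := by
    rw [EuclideanSpace.dist_eq]
    refine Real.sqrt_le_iff.2 ⟨by positivity, ?_⟩
    calc ∑ i, dist (x i) (y i) ^ 2 ≤ ∑ i : Fin d, ((2 : ℝ)⁻¹ ^ n) ^ 2 := by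
          refine Finset.sum_le_sum fun i _ => ?_
          have h1 := hx i
          have h2 := hy i
          gcongr
          rw [Real.dist_eq, abs_le]
          constructor <;> nlinarith
      _ = d * ((2 : ℝ)⁻¹ ^ n) ^ 2 := by simp
      _ ≤ (d * (2 : ℝ)⁻¹ ^ n) ^ 2 := by
          rw [mul_pow]
          gcongr
          rcases Nat.eq_zero_or_pos d with h | h
          · simp [h]
          · exact_mod_cast Nat.le_self_pow two_ne_zero d
  rw [edist_dist, two_rpow_neg_eq_ofReal, ← ENNReal.ofReal_natCast d, ← ENNReal.ofReal_mul (by simp)]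
  exact ENNReal.ofReal_le_ofReal key

/-- The indices adjacent to a given one. -/
noncomputable def neighbours (k : Fin d → ℤ) : Finset (Fin d → ℤ) := Finset.Icc (k - 1) (k + 1)

lemma card_neighbours (k : Fin d → ℤ) : (neighbours k).card = 3 ^ d := by
  rw [neighbours, Pi.card_Icc]
  have (i : Fin d) : (Finset.Icc ((k - 1) i) ((k + 1) i)).card = 3 := by
    simp only [Pi.sub_apply, Pi.add_apply, Pi.one_apply, Int.card_Icc]; omega
  rw [Finset.prod_congr rfl fun i _ => this i]
  simp

/-- After scaling by `2 ^ n` the coordinates differ by at most `1`, hence so do their ceilings. A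
ball of radius `2⁻ⁿ` thus meets at most `3 ^ d` cubes. -/
lemma cubeIndex_mem_neighbours {n : ℕ} {x y : EuclideanSpace ℝ (Fin d)}
    (h : edist x y ≤ (2 : ℝ≥0∞) ^ (-(n : ℝ))) : cubeIndex n x ∈ neighbours (cubeIndex n y) := by
  rw [two_rpow_neg_eq_ofReal, edist_dist, ENNReal.ofReal_le_ofReal_iff (by positivity)] at h
  have key (i : Fin d) : |(2 : ℝ) ^ n * x i - 2 ^ n * y i| ≤ 1 := by
    have h1 : |x i - y i| ≤ (2 : ℝ)⁻¹ ^ n := by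
      have := PiLp.norm_apply_le (x - y) i
      rw [← dist_eq_norm] at this
      simpa using this.trans h
    rw [← mul_sub, abs_mul, abs_of_pos (by positivity)]
    calc (2 : ℝ) ^ n * |x i - y i| ≤ 2 ^ n * (2 : ℝ)⁻¹ ^ n := by gcongr
      _ = 1 := by rw [← mul_pow]; norm_num
  rw [neighbours, Finset.mem_Icc]
  constructor
  · intro i
    have := (abs_le.1 (key i)).1
    have h2 : ⌈(2 : ℝ) ^ n * y i⌉ ≤ ⌈(2 : ℝ) ^ n * x i⌉ + 1 := by
      rw [Int.ceil_le]; push_cast; linarith [Int.le_ceil ((2 : ℝ) ^ n * x i)]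
    simp only [cubeIndex, Pi.sub_apply, Pi.one_apply]; omega
  · intro i
    have := (abs_le.1 (key i)).2
    have h2 : ⌈(2 : ℝ) ^ n * x i⌉ ≤ ⌈(2 : ℝ) ^ n * y i⌉ + 1 := by
      rw [Int.ceil_le]; push_cast; linarith [Int.le_ceil ((2 : ℝ) ^ n * y i)]
    simp only [cubeIndex, Pi.add_apply, Pi.one_apply]; omega

/-- The indices of the level `n + 1` subcubes of the level `n` cube of index `k`. -/
noncomputable def children (k : Fin d → ℤ) : Finset (Fin d → ℤ) := Finset.Icc (2 * k) (2 * k + 1)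

lemma card_children (k : Fin d → ℤ) : (children k).card = 2 ^ d := by
  rw [children, Pi.card_Icc]
  have (i : Fin d) : (Finset.Icc ((2 * k) i) ((2 * k + 1) i)).card = 2 := by
    simp only [Pi.mul_apply, Pi.add_apply, Pi.one_apply, Int.card_Icc]; omega
  rw [Finset.prod_congr rfl fun i _ => this i]
  simp

lemma cubeIndex_succ_mem_children (n : ℕ) (x : EuclideanSpace ℝ (Fin d)) :
    cubeIndex (n + 1) x ∈ children (cubeIndex n x) := by
  have key (i : Fin d) : 2 * ⌈(2 : ℝ) ^ n * x i⌉ - 1 ≤ ⌈(2 : ℝ) ^ (n + 1) * x i⌉ ∧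
      ⌈(2 : ℝ) ^ (n + 1) * x i⌉ ≤ 2 * ⌈(2 : ℝ) ^ n * x i⌉ := by
    have e : (2 : ℝ) ^ (n + 1) * x i = 2 * (2 ^ n * x i) := by ring
    rw [e]
    have h1 := Int.le_ceil ((2 : ℝ) ^ n * x i)
    have h2 := Int.ceil_lt_add_one ((2 : ℝ) ^ n * x i)
    constructor
    -- In the strict form `2⌈t⌉ - 2 < ⌈2t⌉`, the bound reduces to `⌈t⌉ < t + 1`.
    · rw [sub_le_iff_le_add, ← Int.lt_add_one_iff, ← sub_lt_iff_lt_add, ← sub_lt_iff_lt_add]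
      rw [Int.lt_ceil]; push_cast; linarith
    · rw [Int.ceil_le]; push_cast; linarith
  rw [children, Finset.mem_Icc]
  constructor <;> intro i <;> have := key i <;>
    simp only [cubeIndex, Pi.mul_apply, Pi.add_apply, Pi.ofNat_apply] <;> omega

/-! ### Power sums -/

/-- The sum of the `q`-th powers of the nonzero terms of a family. -/
noncomputable def powerSum {ι : Type*} (w : ι → ℝ≥0∞) (q : ℝ) : ℝ≥0∞ :=
  ∑' k, if w k = 0 then 0 else w k ^ q

lemma powerSum_one {ι : Type*} (w : ι → ℝ≥0∞) : powerSum w 1 = ∑' k, w k :=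
  tsum_congr fun k => by split_ifs with h <;> simp [h]

lemma powerSum_of_pos {ι : Type*} (w : ι → ℝ≥0∞) {q : ℝ} (hq : 0 < q) :
    powerSum w q = ∑' k, w k ^ q :=
  tsum_congr fun k => by split_ifs with h <;> simp [h, hq]

lemma powerSum_indicator_le {ι : Type*} (w : ι → ℝ≥0∞) (s : Set ι) (q : ℝ) :
    powerSum (s.indicator w) q ≤ powerSum w q := by
  refine ENNReal.tsum_le_tsum fun k => ?_
  by_cases hk : k ∈ s <;> simp [hk]

lemma powerSum_le_add_compl {ι : Type*} (w : ι → ℝ≥0∞) (s : Set ι) (q : ℝ) :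
    powerSum w q ≤ powerSum (s.indicator w) q + powerSum (sᶜ.indicator w) q := by
  unfold powerSum
  rw [← ENNReal.tsum_add]
  refine ENNReal.tsum_le_tsum fun k => ?_
  by_cases hk : k ∈ s <;> simp [hk]

/-- Power sums are log-convex in the exponent. -/
lemma powerSum_le_mul {ι : Type*} (w : ι → ℝ≥0∞) (hw : ∀ k, w k ≠ ⊤)
    {s : ℝ} (hs0 : 0 ≤ s) (hs1 : s ≤ 1) (p q : ℝ) :
    powerSum w ((1 - s) * p + s * q) ≤ powerSum w p ^ (1 - s) * powerSum w q ^ s := by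
  let m : MeasurableSpace ι := ⊤
  -- Hölder's inequality for counting measure, with exponents `1 / (1 - s)` and `1 / s`.
  have h := ENNReal.lintegral_mul_norm_pow_le (μ := Measure.count)
    (f := fun k => if w k = 0 then 0 else w k ^ p) (g := fun k => if w k = 0 then 0 else w k ^ q)
    measurable_from_top.aemeasurable measurable_from_top.aemeasurable
    (sub_nonneg.2 hs1) hs0 (by ring)
  rw [lintegral_count, lintegral_count, lintegral_count] at h
  refine le_trans (ENNReal.tsum_le_tsum fun k => ?_) h
  split_ifs with h0
  · simp
  · rw [ENNReal.rpow_add _ _ h0 (hw k), ← ENNReal.rpow_mul, ← ENNReal.rpow_mul, mul_comm p,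
      mul_comm q]

variable {ν : Measure (EuclideanSpace ℝ (Fin d))}

lemma dyadicPowerSum_eq (n : ℕ) (q : ℝ) :
    dyadicPowerSum ν n q = powerSum (fun k => ν (dyadicCube n k)) q := rfl

lemma lqSpectrum_eq (q : ℝ) : lqSpectrum ν q = growthRate fun n => dyadicPowerSum ν n q := rfl

lemma tsum_indicator_dyadicCube (n : ℕ) (s : Set (Fin d → ℤ)) :
    ∑' k, s.indicator (fun k => ν (dyadicCube n k)) k = ν (cubeIndex n ⁻¹' s) := by
  rw [← tsum_subtype]
  simp_rw [dyadicCube_eq_preimage]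
  exact tsum_measure_preimage_singleton s.to_countable
    fun y _ => measurable_cubeIndex n (measurableSet_singleton y)

lemma tsum_dyadicCube [IsProbabilityMeasure ν] (n : ℕ) : ∑' k, ν (dyadicCube n k) = 1 := by
  simpa using tsum_indicator_dyadicCube (ν := ν) n univ

lemma dyadicPowerSum_one [IsProbabilityMeasure ν] (n : ℕ) : dyadicPowerSum ν n 1 = 1 := by
  rw [dyadicPowerSum_eq, powerSum_one, tsum_dyadicCube]

lemma one_le_dyadicPowerSum [IsProbabilityMeasure ν] (n : ℕ) {q : ℝ} (hq : q ≤ 1) :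
    1 ≤ dyadicPowerSum ν n q := by
  rw [← dyadicPowerSum_one (ν := ν) n]
  refine ENNReal.tsum_le_tsum fun k => ?_
  split_ifs
  · exact le_rfl
  · exact ENNReal.rpow_le_rpow_of_exponent_ge prob_le_one hq

lemma dyadicPowerSum_le_mul [IsProbabilityMeasure ν] (n : ℕ)
    {s : ℝ} (hs0 : 0 ≤ s) (hs1 : s ≤ 1) (p q : ℝ) :
    dyadicPowerSum ν n ((1 - s) * p + s * q) ≤
      dyadicPowerSum ν n p ^ (1 - s) * dyadicPowerSum ν n q ^ s :=
  powerSum_le_mul _ (fun _ => measure_ne_top _ _) hs0 hs1 p q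

/-- The indices of the level `n` cubes of positive measure. -/
def posCubes (ν : Measure (EuclideanSpace ℝ (Fin d))) (n : ℕ) : Set (Fin d → ℤ) :=
  {k | ν (dyadicCube n k) ≠ 0}

lemma dyadicPowerSum_zero (n : ℕ) : dyadicPowerSum ν n 0 = ((posCubes ν n).encard : ℝ≥0∞) := by
  rw [← ENNReal.tsum_set_one, tsum_subtype (posCubes ν n) (fun _ => (1 : ℝ≥0∞))]
  refine tsum_congr fun k => ?_
  by_cases h : ν (dyadicCube n k) = 0
  · simp [h, posCubes]
  · simp [h, posCubes, indicator]

lemma exists_mem_support_of_mem_posCubes {n : ℕ} {k : Fin d → ℤ} (hk : k ∈ posCubes ν n) :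
    ∃ x ∈ ν.support, cubeIndex n x = k := by
  obtain ⟨x, hx, hx'⟩ := Measure.nonempty_inter_support_of_pos (pos_iff_ne_zero.2 hk)
  exact ⟨x, hx', mem_dyadicCube_iff.1 hx⟩

/-- A bounded set meets `O(2 ^ (n d))` cubes. This makes the spectrum finite, so that it can be
treated as a real function. -/
lemma exists_dyadicPowerSum_zero_le (hν : IsCompact ν.support) :
    ∃ C : ℝ≥0∞, C ≠ ⊤ ∧ ∀ n : ℕ, dyadicPowerSum ν n 0 ≤ C * 2 ^ (n * (d : ℝ)) := by
  obtain ⟨R, hR⟩ := hν.isBounded.exists_norm_le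
  obtain ⟨B, hB⟩ := exists_nat_ge R
  -- Each coordinate of the index takes at most `2 * 2 ^ n * B + 2 ≤ (2 * B + 2) * 2 ^ n` values.
  refine ⟨((2 * B + 2 : ℕ) : ℝ≥0∞) ^ d, ENNReal.pow_ne_top (ENNReal.natCast_ne_top _), fun n => ?_⟩
  have hsub : posCubes ν n ⊆ (Finset.Icc (fun _ => -(2 ^ n * B : ℤ) - 1) (fun _ => (2 ^ n * B : ℤ)) :
      Finset (Fin d → ℤ)) := by
    intro k hk
    obtain ⟨x, hx, rfl⟩ := exists_mem_support_of_mem_posCubes hk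
    have hb (i : Fin d) : |(2 : ℝ) ^ n * x i| ≤ 2 ^ n * B := by
      rw [abs_mul, abs_of_pos (by positivity : (0 : ℝ) < 2 ^ n)]
      gcongr
      exact ((PiLp.norm_apply_le x i).trans (hR x hx)).trans hB
    rw [Finset.coe_Icc]
    constructor <;> intro i <;> have := abs_le.1 (hb i) <;> simp only [cubeIndex]
    · have h2 := (Int.le_ceil ((2 : ℝ) ^ n * x i))
      have : (-(2 ^ n * B : ℤ) : ℤ) ≤ ⌈(2 : ℝ) ^ n * x i⌉ := by
        have h3 : ((-(2 ^ n * B : ℤ) : ℤ) : ℝ) ≤ (⌈(2 : ℝ) ^ n * x i⌉ : ℝ) := by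
          push_cast; linarith
        exact_mod_cast h3
      omega
    · have : ⌈(2 : ℝ) ^ n * x i⌉ ≤ (2 ^ n * B : ℤ) := by
        rw [Int.ceil_le]; push_cast; linarith
      omega
  have hcard : (posCubes ν n).encard ≤ (((2 * B + 2) * 2 ^ n) ^ d : ℕ) := by
    refine (encard_le_encard hsub).trans ?_
    rw [encard_coe_eq_coe_finsetCard, Pi.card_Icc, Finset.prod_const]
    norm_cast
    simp only [Int.card_Icc, Finset.card_univ, Fintype.card_fin]
    refine Nat.pow_le_pow_left ?_ _
    have h1 : 1 ≤ 2 ^ n := Nat.one_le_two_pow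
    zify
    have h2 : (0 : ℤ) ≤ 2 ^ n * B := by positivity
    rw [Int.toNat_of_nonneg (by linarith)]
    zify at h1
    linarith
  rw [dyadicPowerSum_zero]
  calc ((posCubes ν n).encard : ℝ≥0∞) ≤ (((((2 * B + 2) * 2 ^ n) ^ d : ℕ) : ℕ∞) : ℝ≥0∞) := by
        exact_mod_cast hcard
    _ = _ := by
        rw [ENNReal.rpow_mul, ENNReal.rpow_natCast, ENNReal.rpow_natCast, ← mul_pow]
        push_cast
        rfl

lemma dyadicPowerSum_ne_top [IsProbabilityMeasure ν] (hν : IsCompact ν.support) (n : ℕ) {q : ℝ}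
    (hq : 0 ≤ q) : dyadicPowerSum ν n q ≠ ⊤ := by
  obtain ⟨C, hC, h⟩ := exists_dyadicPowerSum_zero_le hν
  have h0 : dyadicPowerSum ν n 0 ≠ ⊤ :=
    ((h n).trans_lt (ENNReal.mul_lt_top hC.lt_top (two_rpow_ne_top _).lt_top)).ne
  refine (lt_of_le_of_lt (ENNReal.tsum_le_tsum fun k => ?_) h0.lt_top).ne
  split_ifs
  · exact le_rfl
  · exact ENNReal.rpow_le_rpow_of_exponent_ge prob_le_one hq

/-! ### Box counting -/

lemma log_div_neg_log_le_iff {a : ℝ≥0∞} {δ : ℝ≥0} (h0 : 0 < δ) (h1 : δ < 1) (v : ℝ) :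
    ENNReal.log a / ((-Real.log (δ : ℝ) : ℝ) : EReal) ≤ v ↔ a ≤ (δ : ℝ≥0∞) ^ (-v) := by
  have h : (0 : ℝ) < -Real.log (δ : ℝ) := by
    rw [neg_pos]; exact Real.log_neg (by exact_mod_cast h0) (by exact_mod_cast h1)
  rw [EReal.div_le_iff_le_mul (by exact_mod_cast h) (EReal.coe_ne_top _), ← EReal.coe_mul,
    ← ENNReal.log_le_log_iff, ENNReal.log_rpow, ENNReal.log_of_nnreal h0.ne', ← EReal.coe_mul]
  ring_nf

/-- A bound for the covering numbers at dyadic scales bounds the upper Minkowski dimension. -/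
lemma upperMinkowskiDim_le {X : Type*} [PseudoEMetricSpace X] {S : Set X} {A : ℝ≥0} (hA : 0 < A)
    {C : ℝ≥0∞} (hC : C ≠ ⊤) {s : ℝ} (hs : 0 ≤ s)
    (h : ∀ᶠ n : ℕ in atTop, ((Metric.externalCoveringNumber (A * 2⁻¹ ^ n) S : ℕ∞) : ℝ≥0∞) ≤
      C * 2 ^ (n * s)) : upperMinkowskiDim S ≤ s := by
  refine EReal.le_of_forall_lt_iff_le.1 fun v hv => ?_
  have hv' : s < v := by exact_mod_cast hv
  refine limsup_le_of_le (by isBoundedDefault) ?_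
  obtain ⟨N, hN⟩ := eventually_atTop.1 h
  have t1 : Tendsto (fun δ : ℝ≥0 => (δ : ℝ≥0∞) ^ (-(v - s))) (𝓝[>] 0) (𝓝 ⊤) := by
    have e : (⊤ : ℝ≥0∞) = ((0 : ℝ≥0) : ℝ≥0∞) ^ (-(v - s)) := by
      rw [ENNReal.coe_zero, ENNReal.zero_rpow_of_neg (by linarith)]
    rw [e]
    exact ((ENNReal.continuous_rpow_const.comp ENNReal.continuous_coe).tendsto 0).mono_left
      nhdsWithin_le_nhds
  have hK : C * (2 * A : ℝ≥0∞) ^ s < ⊤ :=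
    ENNReal.mul_lt_top hC.lt_top (ENNReal.rpow_lt_top_of_nonneg hs (by finiteness))
  have t2 : ∀ᶠ δ : ℝ≥0 in 𝓝[>] 0, δ < min 1 (A * 2⁻¹ ^ (N + 1)) :=
    nhdsWithin_le_nhds (eventually_lt_nhds (by positivity))
  filter_upwards [t1.eventually_const_lt hK, t2, self_mem_nhdsWithin] with δ h1 h2 h0
  have h0 : 0 < δ := h0
  rw [lt_min_iff] at h2
  rw [log_div_neg_log_le_iff h0 h2.1]
  have hbig : (2 : ℝ≥0) ^ (N + 1) ≤ A / δ := by
    rw [le_div_iff₀ h0]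
    have := h2.2.le
    rw [inv_pow, ← div_eq_mul_inv, le_div_iff₀ (by positivity)] at this
    rwa [mul_comm]
  -- Sandwiches `δ` between consecutive scales: `A 2^(-(n+1)) < δ ≤ A 2^(-n)`.
  obtain ⟨n, hn1, hn2⟩ := exists_nat_pow_near (x := A / δ) (y := (2 : ℝ≥0))
    ((one_le_pow₀ (by norm_num)).trans hbig) (by norm_num)
  have hNn : N ≤ n + 1 := by
    have := (pow_lt_pow_iff_right₀ (by norm_num : (1 : ℝ≥0) < 2)).1 (hbig.trans_lt hn2)
    omega
  have hδ : A * 2⁻¹ ^ (n + 1) ≤ δ := by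
    rw [div_lt_iff₀ h0] at hn2
    rw [inv_pow, ← div_eq_mul_inv, div_le_iff₀ (by positivity), mul_comm]
    exact hn2.le
  have hpow : (2 : ℝ≥0∞) ^ (((n + 1 : ℕ) : ℝ)) ≤ 2 * A * (δ : ℝ≥0∞)⁻¹ := by
    rw [ENNReal.rpow_natCast, pow_succ, mul_comm, mul_assoc]
    gcongr
    rw [← ENNReal.coe_inv h0.ne', ← ENNReal.coe_mul, ← div_eq_mul_inv]
    exact_mod_cast hn1
  calc ((Metric.externalCoveringNumber δ S : ℕ∞) : ℝ≥0∞)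
      ≤ ((Metric.externalCoveringNumber (A * 2⁻¹ ^ (n + 1)) S : ℕ∞) : ℝ≥0∞) := by
        exact_mod_cast Metric.externalCoveringNumber_anti hδ
    _ ≤ C * 2 ^ (((n + 1 : ℕ) : ℝ) * s) := hN _ hNn
    _ ≤ C * (2 * A * (δ : ℝ≥0∞)⁻¹) ^ s := by
        rw [ENNReal.rpow_mul]
        gcongr
    _ = (C * (2 * A : ℝ≥0∞) ^ s) * (δ : ℝ≥0∞) ^ (-s) := by
        rw [ENNReal.mul_rpow_of_nonneg _ _ hs, ENNReal.inv_rpow, ENNReal.rpow_neg, mul_assoc]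
    _ ≤ (δ : ℝ≥0∞) ^ (-(v - s)) * (δ : ℝ≥0∞) ^ (-s) := by gcongr
    _ = (δ : ℝ≥0∞) ^ (-v) := by
        rw [← ENNReal.rpow_add _ _ (by exact_mod_cast h0.ne') ENNReal.coe_ne_top]
        ring_nf

lemma coe_two_inv_pow (n : ℕ) : (((2⁻¹ : ℝ≥0) ^ n : ℝ≥0) : ℝ≥0∞) = (2 : ℝ≥0∞) ^ (-(n : ℝ)) := by
  rw [ENNReal.rpow_neg, ENNReal.rpow_natCast, ENNReal.coe_pow, ENNReal.coe_inv (by norm_num),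
    ENNReal.inv_pow]
  norm_num

/-- Covering a set by finitely many dyadic cubes bounds its covering number. -/
lemma externalCoveringNumber_le_encard (n : ℕ) {S : Set (EuclideanSpace ℝ (Fin d))}
    {E : Set (Fin d → ℤ)} (h : ∀ x ∈ S, ∃ y, edist x y ≤ (2 : ℝ≥0∞) ^ (-(n : ℝ)) ∧
      cubeIndex n y ∈ E) :
    Metric.externalCoveringNumber (((d + 1 : ℕ) : ℝ≥0) * 2⁻¹ ^ n) S ≤ E.encard := by
  -- The factor `d + 1` is `1` for the step from `x` to `y` plus `d` for the diameter of the cube of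
  -- `y`.
  have hcov : Metric.IsCover (((d + 1 : ℕ) : ℝ≥0) * 2⁻¹ ^ n) S (cubeCorner n '' E) := by
    intro x hx
    obtain ⟨y, hxy, hy⟩ := h x hx
    refine ⟨_, mem_image_of_mem _ hy, ?_⟩
    change edist x _ ≤ _
    rw [ENNReal.coe_mul, coe_two_inv_pow]
    calc edist x (cubeCorner n (cubeIndex n y))
        ≤ edist x y + edist y (cubeCorner n (cubeIndex n y)) := edist_triangle _ _ _
      _ ≤ 2 ^ (-(n : ℝ)) + d * 2 ^ (-(n : ℝ)) := by
          gcongr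
          exact edist_le_of_mem_dyadicCube (mem_dyadicCube_cubeIndex n y) (cubeCorner_mem _ _)
      _ = _ := by push_cast; ring
  exact hcov.externalCoveringNumber_le_encard.trans (encard_image_le _ _)

/-- A support point on a face may lie in a null cube. A small ball around it has positive mass, so
the countably many null cubes cannot cover that ball. -/
lemma exists_edist_le_of_mem_support {x : EuclideanSpace ℝ (Fin d)} (hx : x ∈ ν.support) (n : ℕ) :
    ∃ y, edist x y ≤ (2 : ℝ≥0∞) ^ (-(n : ℝ)) ∧ cubeIndex n y ∈ posCubes ν n := by
  have hU : Metric.closedEBall x ((2 : ℝ≥0∞) ^ (-(n : ℝ))) ∈ 𝓝 x :=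
    Metric.closedEBall_mem_nhds _ (pos_iff_ne_zero.2 (two_rpow_ne_zero _))
  have hpos := (Measure.mem_support_iff_forall x).1 hx _ hU
  by_contra! hno
  refine hpos.ne' (measure_mono_null (t := ⋃ k ∈ (posCubes ν n)ᶜ, dyadicCube n k) ?_ ?_)
  · intro y hy
    have := hno y (by rw [edist_comm]; exact hy)
    exact mem_biUnion this (mem_dyadicCube_cubeIndex n y)
  · rw [measure_biUnion_null_iff (to_countable _)]
    intro k hk
    simpa [posCubes] using hk

/-- Every cube of positive mass meets the support, and each covering ball accounts for at most `3 ^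
d` cubes. -/
lemma dyadicPowerSum_zero_le_externalCoveringNumber (n : ℕ) :
    dyadicPowerSum ν n 0 ≤
      3 ^ d * ((Metric.externalCoveringNumber (2⁻¹ ^ n) ν.support : ℕ∞) : ℝ≥0∞) := by
  rw [dyadicPowerSum_zero]
  have key : (posCubes ν n).encard ≤ 3 ^ d * Metric.externalCoveringNumber (2⁻¹ ^ n) ν.support := by
    unfold Metric.externalCoveringNumber
    rw [ENat.mul_iInf_of_ne (pow_ne_zero _ (by norm_num))]
    refine le_iInf fun C => ?_
    by_cases hC : Metric.IsCover (2⁻¹ ^ n) ν.support C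
    swap
    · rw [iInf_neg hC, ENat.mul_top (pow_ne_zero _ (by norm_num))]
      exact le_top
    simp only [hC, iInf_pos]
    rcases C.finite_or_infinite with hfin | hinf
    swap
    · simp [hinf.encard_eq]
    classical
    have hsub : posCubes ν n ⊆
        (hfin.toFinset.biUnion fun c => neighbours (cubeIndex n c) : Finset (Fin d → ℤ)) := by
      intro k hk
      obtain ⟨x, hx, rfl⟩ := exists_mem_support_of_mem_posCubes hk
      obtain ⟨c, hc, hxc⟩ := hC hx
      have hxc : edist x c ≤ ((2⁻¹ ^ n : ℝ≥0) : ℝ≥0∞) := hxc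
      rw [coe_two_inv_pow] at hxc
      simp only [Finset.coe_biUnion, mem_iUnion, Finset.mem_coe]
      exact ⟨c, by simpa using hc, cubeIndex_mem_neighbours hxc⟩
    refine (encard_le_encard hsub).trans ?_
    rw [encard_coe_eq_coe_finsetCard, hfin.encard_eq_coe_toFinset_card, mul_comm]
    exact_mod_cast Finset.card_biUnion_le_card_mul _ _ _ fun c _ => (card_neighbours _).le
  calc ((posCubes ν n).encard : ℝ≥0∞)
      ≤ ((3 ^ d * Metric.externalCoveringNumber (2⁻¹ ^ n) ν.support : ℕ∞) : ℝ≥0∞) := by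
        exact_mod_cast key
    _ = _ := by simp

lemma lqSpectrum_nonneg [IsProbabilityMeasure ν] {q : ℝ} (hq : q ≤ 1) : 0 ≤ lqSpectrum ν q := by
  rw [lqSpectrum_eq, ← EReal.coe_zero]
  exact le_growthRate (Frequently.of_forall fun n => by simpa using one_le_dyadicPowerSum n hq)

lemma lqSpectrum_one [IsProbabilityMeasure ν] : lqSpectrum ν 1 = 0 := by
  refine le_antisymm ?_ (lqSpectrum_nonneg le_rfl)
  rw [lqSpectrum_eq, ← EReal.coe_zero]
  exact growthRate_le ENNReal.one_ne_top (Eventually.of_forall fun n => by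
    simp [dyadicPowerSum_one])

/-- At `q = 0` the power sum counts the charged cubes, which is comparable to the covering number of
the support up to constant factors in count and scale. -/
lemma lqSpectrum_zero [IsProbabilityMeasure ν] : lqSpectrum ν 0 = upperMinkowskiDimMeasure ν := by
  apply le_antisymm
  · refine EReal.le_of_forall_lt_iff_le.1 fun v hv => ?_
    have h1 : ∀ᶠ δ : ℝ≥0 in 𝓝[>] 0, ENNReal.log
        ((Metric.externalCoveringNumber δ ν.support : ℕ∞) : ℝ≥0∞)
        / ((-Real.log (δ : ℝ) : ℝ) : EReal) < v := eventually_lt_of_limsup_lt hv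
    have ht : Tendsto (fun n : ℕ => (2⁻¹ : ℝ≥0) ^ n) atTop (𝓝[>] 0) :=
      tendsto_nhdsWithin_iff.2 ⟨tendsto_pow_atTop_nhds_zero_of_lt_one (by norm_num) (by
        rw [inv_lt_one₀] <;> norm_num), Eventually.of_forall fun n => by simp⟩
    rw [lqSpectrum_eq]
    refine growthRate_le (C := 3 ^ d) (by simp) ?_
    filter_upwards [ht.eventually h1, eventually_gt_atTop 0] with n hn hn0
    have hlt : (2⁻¹ : ℝ≥0) ^ n < 1 := pow_lt_one₀ (by simp) (by rw [inv_lt_one₀] <;> norm_num) hn0.ne'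
    have h2 := (log_div_neg_log_le_iff (by positivity) hlt v).1 hn.le
    rw [coe_two_inv_pow, ← ENNReal.rpow_mul, neg_mul_neg] at h2
    exact (dyadicPowerSum_zero_le_externalCoveringNumber n).trans (by gcongr)
  · refine EReal.le_of_forall_lt_iff_le.1 fun v hv => ?_
    have hv0 : (0 : ℝ) ≤ v := by
      have := (lqSpectrum_nonneg (ν := ν) zero_le_one).trans hv.le
      exact_mod_cast this
    refine upperMinkowskiDim_le (A := ((d + 1 : ℕ) : ℝ≥0)) (by positivity) ENNReal.one_ne_top hv0 ?_
    filter_upwards [eventually_le_of_growthRate_lt hv] with n hn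
    rw [one_mul]
    refine le_trans ?_ hn
    rw [dyadicPowerSum_zero]
    exact_mod_cast externalCoveringNumber_le_encard n fun x hx => exists_edist_le_of_mem_support hx n

/-! ### Convexity of the spectrum -/

/-- A convex function on `[0, 1]` vanishing at `1` and touching the chord in the interior agrees
with the chord. -/
lemma eq_chord_of_convexOn {f : ℝ → ℝ} (hf : ConvexOn ℝ (Icc 0 1) f) (f1 : f 1 = 0) {q : ℝ}
    (hq : q ∈ Ioo (0 : ℝ) 1) (h : f 0 * (1 - q) ≤ f q) {p : ℝ} (hp : p ∈ Icc (0 : ℝ) 1) :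
    f p = f 0 * (1 - p) := by
  obtain ⟨hq0, hq1⟩ := hq
  obtain ⟨hp0, hp1⟩ := hp
  have hle : f p ≤ f 0 * (1 - p) := by
    have := hf.2 (left_mem_Icc.2 zero_le_one) (right_mem_Icc.2 zero_le_one) (sub_nonneg.2 hp1) hp0
      (by ring)
    simp only [smul_eq_mul, mul_zero, mul_one, zero_add, f1, add_zero] at this
    linarith
  refine le_antisymm hle ?_
  -- Either `q` lies between `p` and `1`, or between `0` and `p`. In both cases a value strictly
  -- below the chord at `p` would pull `f q` below it.
  rcases le_or_gt p q with hpq | hpq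
  · have hp1' : 0 < 1 - p := by linarith
    have := hf.2 ⟨hp0, hp1⟩ (right_mem_Icc.2 zero_le_one)
      (div_nonneg (sub_nonneg.2 hq1.le) hp1'.le)
      (div_nonneg (sub_nonneg.2 hpq) hp1'.le) (by field_simp; ring)
    simp only [smul_eq_mul, f1, mul_zero, add_zero, mul_one] at this
    have e : (1 - q) / (1 - p) * p + (q - p) / (1 - p) = q := by field_simp; ring
    rw [e] at this
    have h2 : f 0 * (1 - q) ≤ (1 - q) / (1 - p) * f p := h.trans this
    rw [div_mul_eq_mul_div, le_div_iff₀ hp1'] at h2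
    have hq1' : 0 < 1 - q := by linarith
    nlinarith
  · have hp : 0 < p := hq0.trans hpq
    have := hf.2 (left_mem_Icc.2 zero_le_one) ⟨hp0, hp1⟩
      (div_nonneg (sub_nonneg.2 hpq.le) hp.le)
      (div_nonneg hq0.le hp.le) (by field_simp; ring)
    simp only [smul_eq_mul, mul_zero, zero_add] at this
    rw [div_mul_cancel₀ _ hp.ne'] at this
    have h2 : f 0 * (1 - q) ≤ ((p - q) * f 0 + q * f p) / p := by
      rw [add_div, mul_div_right_comm, mul_div_right_comm]; exact h.trans this
    rw [le_div_iff₀ hp] at h2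
    nlinarith

/-- Secant slopes of a convex function increase towards the left derivative, so the secant from `q`
to `1` has slope at most `b ≤ -f 0`. -/
lemma chord_le_of_hasDerivWithinAt {f : ℝ → ℝ} (hf : ConvexOn ℝ (Icc 0 1) f) (f1 : f 1 = 0)
    {b : ℝ} (hd : HasDerivWithinAt f b (Iic 1) 1) (hb : b ≤ -f 0) {q : ℝ}
    (hq : q ∈ Ioo (0 : ℝ) 1) : f 0 * (1 - q) ≤ f q := by
  rw [hasDerivWithinAt_iff_tendsto_slope] at hd
  have e : Iic (1 : ℝ) \ {1} = Iio 1 := by ext x; simp [lt_iff_le_and_ne]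
  rw [e] at hd
  have hq1 : 0 < 1 - q := by linarith [hq.2]
  have hs : slope f 1 q ≤ b := by
    refine ge_of_tendsto hd ?_
    filter_upwards [Ioo_mem_nhdsLT hq.2] with x hx
    have := hf.slope_mono (right_mem_Icc.2 zero_le_one) ⟨⟨hq.1.le, hq.2.le⟩, hq.2.ne⟩
      ⟨⟨(hq.1.trans hx.1).le, hx.2.le⟩, hx.2.ne⟩ hx.1.le
    exact this
  have h2 := hs.trans hb
  rw [slope_def_field, f1, sub_zero, ← neg_sub 1 q, div_neg, neg_le_neg_iff, le_div_iff₀ hq1] at h2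
  exact h2

/-- Hölder at each level. Strict bounds `u`, `v` hold for all large `n` simultaneously, which is why
a limsup still inherits convexity. -/
lemma lqSpectrum_convexComb_le [IsProbabilityMeasure ν] {p q u v s : ℝ} (hu : lqSpectrum ν p < u)
    (hv : lqSpectrum ν q < v) (hs0 : 0 ≤ s) (hs1 : s ≤ 1) :
    lqSpectrum ν ((1 - s) * p + s * q) ≤ ((1 - s) * u + s * v : ℝ) := by
  rw [lqSpectrum_eq]
  refine growthRate_le ENNReal.one_ne_top ?_
  filter_upwards [eventually_le_of_growthRate_lt hu, eventually_le_of_growthRate_lt hv]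
    with n h1 h2
  have hs1' : 0 ≤ 1 - s := sub_nonneg.2 hs1
  calc dyadicPowerSum ν n ((1 - s) * p + s * q)
      ≤ dyadicPowerSum ν n p ^ (1 - s) * dyadicPowerSum ν n q ^ s :=
        dyadicPowerSum_le_mul n hs0 hs1 p q
    _ ≤ (2 ^ (n * u)) ^ (1 - s) * (2 ^ (n * v)) ^ s := by gcongr
    _ = 1 * 2 ^ (n * ((1 - s) * u + s * v)) := by
        rw [← ENNReal.rpow_mul, ← ENNReal.rpow_mul, ← two_rpow_add, one_mul]
        ring_nf

lemma lqSpectrum_le [IsProbabilityMeasure ν] (hν : IsCompact ν.support) {q : ℝ} (hq : 0 ≤ q) :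
    lqSpectrum ν q ≤ (d : ℝ) := by
  obtain ⟨C, hC, h⟩ := exists_dyadicPowerSum_zero_le hν
  refine growthRate_le hC (Eventually.of_forall fun n => le_trans ?_ (h n))
  refine ENNReal.tsum_le_tsum fun k => ?_
  split_ifs
  · exact le_rfl
  · exact ENNReal.rpow_le_rpow_of_exponent_ge prob_le_one hq

lemma coe_toReal_lqSpectrum [IsProbabilityMeasure ν] (hν : IsCompact ν.support) {q : ℝ}
    (hq : q ∈ Icc (0 : ℝ) 1) : ((lqSpectrum ν q).toReal : EReal) = lqSpectrum ν q :=
  EReal.coe_toReal ((lqSpectrum_le hν hq.1).trans_lt (EReal.coe_lt_top _)).ne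
    (EReal.bot_lt_zero.trans_le (lqSpectrum_nonneg hq.2)).ne'

lemma convexOn_lqSpectrum [IsProbabilityMeasure ν] (hν : IsCompact ν.support) :
    ConvexOn ℝ (Icc 0 1) fun q => (lqSpectrum ν q).toReal := by
  refine ⟨convex_Icc 0 1, fun p hp q hq a s ha hs has => ?_⟩
  obtain rfl : a = 1 - s := by linarith
  refine le_of_forall_pos_le_add fun ε hε => ?_
  have lt_add {t : ℝ} (ht : t ∈ Icc (0 : ℝ) 1) :
      lqSpectrum ν t < ((lqSpectrum ν t).toReal + ε : ℝ) := by
    conv_lhs => rw [← coe_toReal_lqSpectrum hν ht]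
    exact_mod_cast lt_add_of_pos_right _ hε
  have h := lqSpectrum_convexComb_le (lt_add hp) (lt_add hq) hs (by linarith)
  have hmem := convex_Icc (0 : ℝ) 1 hp hq ha hs has
  simp only [smul_eq_mul] at hmem ⊢
  rw [← coe_toReal_lqSpectrum hν hmem, EReal.coe_le_coe_iff] at h
  linarith

lemma toReal_lqSpectrum_one [IsProbabilityMeasure ν] : (lqSpectrum ν 1).toReal = 0 := by
  simp [lqSpectrum_one]

lemma leftDerivAtOneLE_of_eqOn {D : ℝ}
    (h : ∀ q ∈ Icc (0 : ℝ) 1, (lqSpectrum ν q).toReal = D * (1 - q)) :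
    LeftDerivAtOneLE ν ((-D : ℝ) : EReal) := by
  refine ⟨-D, ?_, le_rfl⟩
  have h1 : HasDerivWithinAt (fun q : ℝ => D * (1 - q)) (-D) (Iic 1) 1 := by
    have := (((hasDerivAt_id (1 : ℝ)).const_sub 1).const_mul D).hasDerivWithinAt (s := Iic 1)
    simpa using this
  refine h1.congr_of_eventuallyEq ?_ (h 1 (right_mem_Icc.2 zero_le_one))
  filter_upwards [self_mem_nhdsWithin, nhdsWithin_le_nhds (Ioi_mem_nhds zero_lt_one)] with q h1 h2
  exact h q ⟨le_of_lt h2, h1⟩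

/-! ### Upper bounds for the quantization dimension -/

lemma tsum_ne_top_of_eventually_le {a : ℕ → ℝ≥0∞} (ha : ∀ n, a n ≠ ⊤) {η : ℝ} (hη : 0 < η)
    (h : ∀ᶠ n : ℕ in atTop, a n ≤ 2 ^ (-(n * η))) : ∑' n, a n ≠ ⊤ := by
  obtain ⟨N, hN⟩ := eventually_atTop.1 h
  rw [← ENNReal.summable.sum_add_tsum_nat_add' (k := N)]
  refine ENNReal.add_ne_top.2 ⟨ENNReal.sum_ne_top.2 fun n _ => ha n, ?_⟩
  have hρ : (2 : ℝ≥0∞) ^ (-η) < 1 := ENNReal.rpow_lt_one_of_one_lt_of_neg (by norm_num) (by linarith)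
  have hle : ∑' n, a (n + N) ≤ ∑' n, ((2 : ℝ≥0∞) ^ (-η)) ^ n := by
    refine ENNReal.tsum_le_tsum fun n => (hN _ (Nat.le_add_left _ _)).trans ?_
    rw [← ENNReal.rpow_natCast, ← ENNReal.rpow_mul]
    refine two_rpow_le_two_rpow ?_
    push_cast
    nlinarith [mul_nonneg (Nat.cast_nonneg (α := ℝ) N) hη.le]
  rw [ENNReal.tsum_geometric] at hle
  refine (hle.trans_lt ?_).ne
  rw [ENNReal.inv_lt_top]
  exact tsub_pos_of_lt hρ

/-- Induction on the codebook: the new point is compared with the best earlier choice, and ties are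
resolved measurably. -/
lemma exists_measurable_nearest {X : Type*} [PseudoEMetricSpace X] [MeasurableSpace X]
    [OpensMeasurableSpace X] [SecondCountableTopology X] {A : Finset X} (hA : A.Nonempty) :
    ∃ f : X → X, Measurable f ∧ range f ⊆ A ∧ ∀ x, ∀ a ∈ A, edist x (f x) ≤ edist x a := by
  induction hA using Finset.Nonempty.cons_induction with
  | singleton a => exact ⟨fun _ => a, measurable_const, by simp, by simp⟩
  | cons a s ha hs ih =>
    obtain ⟨f, hf, hr, hmin⟩ := ih
    classical
    refine ⟨fun x => if edist x (f x) ≤ edist x a then f x else a, ?_, ?_, ?_⟩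
    · exact Measurable.ite (measurableSet_le (measurable_id.edist hf)
        (measurable_id.edist measurable_const)) hf measurable_const
    · rintro _ ⟨x, rfl⟩
      simp only
      split_ifs
      · simpa using Or.inr (hr (mem_range_self x))
      · simp
    · intro x b hb
      simp only
      rcases Finset.mem_cons.1 hb with rfl | hb
      · split_ifs with h
        · exact h
        · exact le_rfl
      · split_ifs with h
        · exact hmin x b hb
        · exact (not_le.1 h).le.trans (hmin x b hb)

lemma ae_cubeIndex_mem_posCubes (n : ℕ) : ∀ᵐ x ∂ν, cubeIndex n x ∈ posCubes ν n := by
  rw [ae_iff]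
  refine measure_mono_null (t := ⋃ k ∈ (posCubes ν n)ᶜ, dyadicCube n k) ?_ ?_
  · intro y hy
    exact mem_biUnion hy (mem_dyadicCube_cubeIndex n y)
  · rw [measure_biUnion_null_iff (to_countable _)]
    intro k hk
    simpa [posCubes] using hk

/-- The mass of a dyadic cube weighted by the `r`-th power of its side length. -/
noncomputable def cubeWeight (ν : Measure (EuclideanSpace ℝ (Fin d))) (r : ℝ)
    (p : ℕ × (Fin d → ℤ)) : ℝ≥0∞ :=
  ν (dyadicCube p.1 p.2) * 2 ^ (-(p.1 * r))

/-- The corners of the dyadic cubes of weight at least `t` form an efficient codebook. -/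
lemma quantError_le_of_cubeWeight [IsProbabilityMeasure ν] {r : ℝ} (hr : 0 < r) {t : ℝ≥0∞}
    {G : Finset (ℕ × (Fin d → ℤ))} (hG : ∀ p, p ∈ G ↔ t ≤ cubeWeight ν r p)
    (h0 : ∀ k ∈ posCubes ν 0, (0, k) ∈ G) {m : ℕ} (hm : G.card ≤ m) :
    quantError ν m r ≤ ((d : ℝ≥0∞) ^ r * 2 ^ d * 2 ^ r * (m * t)) ^ (1 / r) := by
  classical
  obtain ⟨x₀, hx₀⟩ := (ae_cubeIndex_mem_posCubes (ν := ν) 0).exists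
  have hGne : G.Nonempty := ⟨_, h0 _ hx₀⟩
  obtain ⟨f, hf, hfr, hmin⟩ := exists_measurable_nearest
    (hGne.image fun p => (cubeCorner p.1 p.2 : EuclideanSpace ℝ (Fin d)))
  have hcard : (range f).encard ≤ m := by
    refine (encard_le_encard hfr).trans ?_
    rw [encard_coe_eq_coe_finsetCard]
    exact_mod_cast Finset.card_image_le.trans hm
  refine (iInf₂_le f ⟨hf, hcard⟩).trans ?_
  refine ENNReal.rpow_le_rpow ?_ (by positivity)
  -- `R p` is the part of the cube `p` whose next subcube leaves `G`. Since `G` is finite, almost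
  -- every chain of cubes, starting in `G` at level `0`, leaves it, so these sets cover almost
  -- everything.
  let R (p : ℕ × (Fin d → ℤ)) : Set (EuclideanSpace ℝ (Fin d)) :=
    dyadicCube p.1 p.2 ∩ {x | (p.1 + 1, cubeIndex (p.1 + 1) x) ∉ G}
  have hRm (p) : MeasurableSet (R p) :=
    (measurableSet_dyadicCube _ _).inter ((measurable_cubeIndex (p.1 + 1))
      (MeasurableSet.of_discrete (s := {k | (p.1 + 1, k) ∉ G})))
  have hmem : ∀ᵐ x ∂ν, ∃ p ∈ G, x ∈ R p := by
    filter_upwards [ae_cubeIndex_mem_posCubes (ν := ν) 0] with x hx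
    by_contra! hno
    have hall (n : ℕ) : (n, cubeIndex n x) ∈ G := by
      induction n with
      | zero => exact h0 _ hx
      | succ n ih =>
        by_contra hn
        exact hno _ ih ⟨mem_dyadicCube_cubeIndex n x, hn⟩
    exact (infinite_of_injective_forall_mem (s := (G : Set (ℕ × (Fin d → ℤ))))
      (f := fun n : ℕ => (n, cubeIndex n x)) (fun a b h => (Prod.mk.inj h).1) hall)
      G.finite_toSet
  have hpt : ∀ᵐ x ∂ν, ‖x - f x‖ₑ ^ r ≤
      ∑ p ∈ G, (R p).indicator (fun _ => (d * (2 : ℝ≥0∞) ^ (-(p.1 : ℝ))) ^ r) x := by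
    filter_upwards [hmem] with x ⟨p, hp, hx⟩
    refine le_trans ?_ (Finset.single_le_sum (f := fun p => (R p).indicator
      (fun _ => (d * (2 : ℝ≥0∞) ^ (-(p.1 : ℝ))) ^ r) x) (fun _ _ => zero_le) hp)
    simp only [indicator_of_mem hx]
    rw [← edist_eq_enorm_sub]
    refine ENNReal.rpow_le_rpow ?_ hr.le
    exact (hmin x _ (Finset.mem_image_of_mem _ hp)).trans
      (edist_le_of_mem_dyadicCube hx.1 (cubeCorner_mem _ _))
  -- At most `2 ^ d` children leave `G`, each of weight below `t`.
  have hRν (p) : ν (R p) ≤ 2 ^ d * (t * 2 ^ (((p.1 : ℝ) + 1) * r)) := by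
    have hsub : R p ⊆ ⋃ k ∈ (children p.2).filter (fun k => (p.1 + 1, k) ∉ G),
        dyadicCube (p.1 + 1) k := by
      rintro x ⟨hx, hxG⟩
      refine mem_biUnion (x := cubeIndex (p.1 + 1) x) ?_ (mem_dyadicCube_cubeIndex _ x)
      have := cubeIndex_succ_mem_children p.1 x
      rw [mem_dyadicCube_iff.1 hx] at this
      simpa using ⟨this, hxG⟩
    refine (measure_mono hsub).trans ((measure_biUnion_finset_le _ _).trans ?_)
    refine (Finset.sum_le_card_nsmul _ _ (t * 2 ^ (((p.1 : ℝ) + 1) * r)) ?_).trans ?_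
    · intro k hk
      have hk := (Finset.mem_filter.1 hk).2
      rw [hG, not_le, cubeWeight] at hk
      calc ν (dyadicCube (p.1 + 1) k)
          = ν (dyadicCube (p.1 + 1) k) * 2 ^ (-(((p.1 + 1 : ℕ) : ℝ) * r)) *
              2 ^ (((p.1 : ℝ) + 1) * r) := by
            rw [mul_assoc, ← two_rpow_add]; push_cast; simp
        _ ≤ _ := by gcongr
    · rw [nsmul_eq_mul]
      gcongr
      exact_mod_cast (Finset.card_filter_le _ _).trans (card_children p.2).le
  calc ∫⁻ x, ‖x - f x‖ₑ ^ r ∂ν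
      ≤ ∫⁻ x, ∑ p ∈ G, (R p).indicator (fun _ => (d * (2 : ℝ≥0∞) ^ (-(p.1 : ℝ))) ^ r) x ∂ν :=
        lintegral_mono_ae hpt
    _ = ∑ p ∈ G, (d * (2 : ℝ≥0∞) ^ (-(p.1 : ℝ))) ^ r * ν (R p) := by
        rw [lintegral_finsetSum _ fun p _ => measurable_const.indicator (hRm p)]
        exact Finset.sum_congr rfl fun p _ => lintegral_indicator_const (hRm p) _
    -- The factor `2^(-n r)` from the distance cancels `2^((n+1) r)` from the mass bound up to `2 ^
    -- r`, so all levels cost the same.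
    _ ≤ ∑ p ∈ G, (d : ℝ≥0∞) ^ r * 2 ^ d * 2 ^ r * t := by
        refine Finset.sum_le_sum fun p _ => ?_
        calc (d * (2 : ℝ≥0∞) ^ (-(p.1 : ℝ))) ^ r * ν (R p)
            ≤ (d * (2 : ℝ≥0∞) ^ (-(p.1 : ℝ))) ^ r * (2 ^ d * (t * 2 ^ (((p.1 : ℝ) + 1) * r))) := by
              gcongr; exact hRν p
          _ = (d : ℝ≥0∞) ^ r * 2 ^ d * t *
                (2 ^ (-(p.1 : ℝ) * r) * 2 ^ (((p.1 : ℝ) + 1) * r)) := by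
              rw [ENNReal.mul_rpow_of_nonneg _ _ hr.le, ← ENNReal.rpow_mul]; ring
          _ = _ := by
              rw [← two_rpow_add, show -(p.1 : ℝ) * r + ((p.1 : ℝ) + 1) * r = r by ring]; ring
    _ = (d : ℝ≥0∞) ^ r * 2 ^ d * 2 ^ r * (G.card * t) := by
        rw [Finset.sum_const, nsmul_eq_mul]; ring
    _ ≤ _ := by gcongr

/-- Level `n` contributes the power sum times `2^(-n r q)`, which decays geometrically when `β(q) <
r q`. -/
lemma tsum_cubeWeight_rpow_ne_top [IsProbabilityMeasure ν] (hν : IsCompact ν.support) {r q : ℝ}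
    (hq : 0 < q) (h : lqSpectrum ν q < ((r * q : ℝ) : EReal)) :
    ∑' p, cubeWeight ν r p ^ q ≠ ⊤ := by
  have e (n : ℕ) : ∑' k, cubeWeight ν r (n, k) ^ q =
      dyadicPowerSum ν n q * 2 ^ (-(n * (r * q))) := by
    rw [dyadicPowerSum_eq, powerSum_of_pos _ hq, ← ENNReal.tsum_mul_right]
    refine tsum_congr fun k => ?_
    rw [cubeWeight, ENNReal.mul_rpow_of_nonneg _ _ hq.le, ← ENNReal.rpow_mul]
    ring_nf
  rw [ENNReal.tsum_prod']
  simp_rw [e]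
  obtain ⟨u, hu, hur⟩ := EReal.lt_iff_exists_real_btwn.1 h
  have hur : u < r * q := by exact_mod_cast hur
  refine tsum_ne_top_of_eventually_le (fun n => ENNReal.mul_ne_top
    (dyadicPowerSum_ne_top hν n hq.le) (two_rpow_ne_top _)) (sub_pos.2 hur) ?_
  filter_upwards [eventually_le_of_growthRate_lt hu] with n hn
  calc dyadicPowerSum ν n q * 2 ^ (-(n * (r * q)))
      ≤ 2 ^ (n * u) * 2 ^ (-(n * (r * q))) := by gcongr
    _ = _ := by rw [← two_rpow_add]; ring_nf

lemma finite_posCubes (hν : IsCompact ν.support) (n : ℕ) : (posCubes ν n).Finite := by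
  obtain ⟨C, hC, h⟩ := exists_dyadicPowerSum_zero_le hν
  have h0 : dyadicPowerSum ν n 0 ≠ ⊤ :=
    ((h n).trans_lt (ENNReal.mul_lt_top hC.lt_top (two_rpow_ne_top _).lt_top)).ne
  rw [dyadicPowerSum_zero] at h0
  exact encard_ne_top_iff.1 (by simpa using h0)

/-- The quantization error decays polynomially, with exponent determined by any `q` for which
`β_ν(q) < r q`. -/
lemma exists_quantError_le [IsProbabilityMeasure ν] (hν : IsCompact ν.support) {r q : ℝ}
    (hr : 0 < r) (hq : 0 < q) (h : lqSpectrum ν q < ((r * q : ℝ) : EReal)) :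
    ∃ C : ℝ≥0∞, C ≠ ⊤ ∧ ∀ᶠ m : ℕ in atTop,
      quantError ν m r ≤ C * (m : ℝ≥0∞) ^ (-((1 - q) / (r * q))) := by
  set T : ℝ≥0∞ := max (∑' p, cubeWeight ν r p ^ q) 1 with hTdef
  have hT : T ≠ ⊤ := by simpa [hTdef] using tsum_cubeWeight_rpow_ne_top hν hq h
  have hT0 : T ≠ 0 := (zero_lt_one.trans_le (le_max_right _ _)).ne'
  let c : ℝ≥0∞ := (d : ℝ≥0∞) ^ r * 2 ^ d * 2 ^ r
  have hc : c ≠ ⊤ := ENNReal.mul_ne_top (ENNReal.mul_ne_top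
    (ENNReal.rpow_ne_top_of_nonneg hr.le (by simp)) (by simp)) (by simp)
  refine ⟨(c * T ^ (1 / q)) ^ (1 / r), ENNReal.rpow_ne_top_of_nonneg (by positivity)
    (ENNReal.mul_ne_top hc (ENNReal.rpow_ne_top_of_nonneg (by positivity) hT)), ?_⟩
  -- The threshold is `t = (T / m) ^ (1 / q)`: by Markov at most `m` cubes have weight at least `t`,
  -- and `m t = T^(1/q) m^(1 - 1/q)` gives the exponent. As `t` tends to `0`, the finitely many
  -- charged cubes of level `0` are eventually included.
  have ht : Tendsto (fun m : ℕ => (T / m) ^ (1 / q)) atTop (𝓝 0) := by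
    have h1 : Tendsto (fun m : ℕ => T / (m : ℝ≥0∞)) atTop (𝓝 0) := by
      have := ENNReal.Tendsto.const_div (a := T) ENNReal.tendsto_nat_nhds_top (Or.inr hT)
      simpa using this
    have h2 := ((ENNReal.continuous_rpow_const (y := 1 / q)).tendsto 0).comp h1
    rwa [ENNReal.zero_rpow_of_pos (by positivity)] at h2
  have hlev : ∀ᶠ m : ℕ in atTop, ∀ k ∈ posCubes ν 0, (T / m) ^ (1 / q) < cubeWeight ν r (0, k) := by
    rw [(finite_posCubes hν 0).eventually_all]
    intro k hk
    refine ht.eventually_lt_const ?_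
    have hk : ν (dyadicCube 0 k) ≠ 0 := hk
    simpa [cubeWeight, pos_iff_ne_zero] using hk
  filter_upwards [hlev, eventually_gt_atTop 0] with m hm hm0
  have hm0' : (m : ℝ≥0∞) ≠ 0 := by exact_mod_cast hm0.ne'
  have hmt : (m : ℝ≥0∞) ≠ ⊤ := ENNReal.natCast_ne_top m
  obtain ⟨hfin, hcard⟩ := ENNReal.finset_card_const_le_le_of_tsum_le hT (le_max_left _ _)
    (ε := T / m) (ENNReal.div_ne_zero.2 ⟨hT0, hmt⟩)
  have hiff (p) : T / m ≤ cubeWeight ν r p ^ q ↔ (T / m) ^ (1 / q) ≤ cubeWeight ν r p := by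
    rw [one_div, ENNReal.rpow_inv_le_iff hq]
  have hle := quantError_le_of_cubeWeight (ν := ν) hr (t := (T / m) ^ (1 / q)) (G := hfin.toFinset)
    (fun p => by simp [hiff]) (fun k hk => by
      rw [Finite.mem_toFinset, mem_ofPred_eq, hiff]; exact (hm k hk).le) (m := m) (by
      have e : T / (T / m) = m := by
        rw [div_eq_mul_inv T (m : ℝ≥0∞), ENNReal.div_eq_inv_mul, ENNReal.mul_inv (Or.inl hT0) (Or.inl hT),
          inv_inv, mul_right_comm, ENNReal.inv_mul_cancel hT0 hT, one_mul]
      rw [e] at hcard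
      exact_mod_cast hcard)
  refine hle.trans (le_of_eq ?_)
  change (c * _) ^ (1 / r) = _
  have e : (m : ℝ≥0∞) * (T / m) ^ (1 / q) = T ^ (1 / q) * (m : ℝ≥0∞) ^ (1 - 1 / q) := by
    rw [ENNReal.div_rpow_of_nonneg _ _ (by positivity), ENNReal.rpow_sub _ _ hm0' hmt,
      ENNReal.rpow_one]
    simp only [div_eq_mul_inv]
    ring
  rw [e, ← mul_assoc, ENNReal.mul_rpow_of_nonneg _ _ (by positivity : 0 ≤ 1 / r), ← ENNReal.rpow_mul]
  congr 2
  field_simp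
  ring

lemma log_div_neg_log_le {m : ℕ} (hm : 2 ≤ m) {e : ℝ≥0∞} {v : ℝ} (hv : 0 < v)
    (h : e ≤ (m : ℝ≥0∞) ^ (-v⁻¹)) :
    ((Real.log m : ℝ) : EReal) / (-ENNReal.log e) ≤ v := by
  have hlog : 0 < Real.log m := Real.log_pos (by exact_mod_cast hm)
  have hm0 : (m : ℝ≥0∞) ≠ 0 := by
    have : m ≠ 0 := by omega
    exact_mod_cast this
  have h1 := ENNReal.log_le_log h
  rw [ENNReal.log_rpow, ENNReal.log_pos_real hm0 (ENNReal.natCast_ne_top m), ENNReal.toReal_natCast,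
    ← EReal.coe_mul] at h1
  induction hb : ENNReal.log e with
  -- Zero error: the denominator is `⊤` and the quotient is `0`.
  | bot => simpa [hb] using hv.le
  | top =>
    rw [hb] at h1
    exact absurd (top_le_iff.1 h1) (EReal.coe_ne_top _)
  | coe b =>
    rw [hb, EReal.coe_le_coe_iff] at h1
    have hb0 : 0 < -b := by
      have : 0 < v⁻¹ * Real.log m := by positivity
      linarith
    rw [← EReal.coe_neg, ← EReal.coe_div, EReal.coe_le_coe_iff, div_le_iff₀ hb0]
    have h2 : v⁻¹ * Real.log m ≤ -b := by linarith
    calc Real.log m = v * (v⁻¹ * Real.log m) := by field_simp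
      _ ≤ v * -b := by gcongr

lemma eventually_le_natCast_rpow {C : ℝ≥0∞} (hC : C ≠ ⊤) {η : ℝ} (hη : 0 < η) :
    ∀ᶠ m : ℕ in atTop, C ≤ (m : ℝ≥0∞) ^ η := by
  have h : Tendsto (fun m : ℕ => (m : ℝ≥0∞) ^ η) atTop (𝓝 ⊤) := by
    have := ((ENNReal.continuous_rpow_const (y := η)).tendsto ⊤).comp ENNReal.tendsto_nat_nhds_top
    rwa [ENNReal.top_rpow_of_pos hη] at this
  filter_upwards [h.eventually_const_lt hC.lt_top] with m hm using hm.le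

lemma eventually_quantError_le [IsProbabilityMeasure ν] (hν : IsCompact ν.support) {r q κ : ℝ}
    (hr : 0 < r) (hq : 0 < q) (h : lqSpectrum ν q < ((r * q : ℝ) : EReal))
    (hκ : κ < (1 - q) / (r * q)) :
    ∀ᶠ m : ℕ in atTop, quantError ν m r ≤ (m : ℝ≥0∞) ^ (-κ) := by
  obtain ⟨C, hC, hle⟩ := exists_quantError_le hν hr hq h
  filter_upwards [hle, eventually_le_natCast_rpow hC (sub_pos.2 hκ), eventually_gt_atTop 0]
    with m h1 h2 hm0
  calc quantError ν m r ≤ C * (m : ℝ≥0∞) ^ (-((1 - q) / (r * q))) := h1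
    _ ≤ (m : ℝ≥0∞) ^ ((1 - q) / (r * q) - κ) * (m : ℝ≥0∞) ^ (-((1 - q) / (r * q))) := by gcongr
    _ = _ := by
      rw [← ENNReal.rpow_add _ _ (by exact_mod_cast hm0.ne') (ENNReal.natCast_ne_top m)]
      ring_nf

lemma upperQuantDim_le [IsProbabilityMeasure ν] (hν : IsCompact ν.support) {r q : ℝ}
    (hr : 0 < r) (hq : q ∈ Ioo (0 : ℝ) 1) (h : lqSpectrum ν q < ((r * q : ℝ) : EReal)) :
    upperQuantDim ν r ≤ ((r * q / (1 - q) : ℝ) : EReal) := by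
  refine EReal.le_of_forall_lt_iff_le.1 fun v hv => ?_
  have hv' : r * q / (1 - q) < v := by exact_mod_cast hv
  have hq1 : 0 < 1 - q := sub_pos.2 hq.2
  have hrq : 0 < r * q := mul_pos hr hq.1
  have hv0 : 0 < v := (div_pos hrq hq1).trans hv'
  refine limsup_le_of_le (by isBoundedDefault) ?_
  have hκ : v⁻¹ < (1 - q) / (r * q) := by
    rw [← inv_div]; exact inv_strictAnti₀ (div_pos hrq hq1) hv'
  filter_upwards [eventually_quantError_le hν hr hq.1 h hκ, eventually_ge_atTop 2] with m h1 h2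
  exact log_div_neg_log_le h2 hv0 h1

lemma toReal_lqSpectrum_le [IsProbabilityMeasure ν] (hν : IsCompact ν.support) {q : ℝ}
    (hq : q ∈ Icc (0 : ℝ) 1) :
    (lqSpectrum ν q).toReal ≤ (lqSpectrum ν 0).toReal * (1 - q) := by
  have := (convexOn_lqSpectrum hν).2 (left_mem_Icc.2 zero_le_one) (right_mem_Icc.2 zero_le_one)
    (sub_nonneg.2 hq.2) hq.1 (by ring)
  simp only [smul_eq_mul, mul_zero, mul_one, zero_add, toReal_lqSpectrum_one, add_zero] at this
  linarith

lemma lqSpectrum_lt_iff [IsProbabilityMeasure ν] (hν : IsCompact ν.support) {q u : ℝ}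
    (hq : q ∈ Icc (0 : ℝ) 1) : lqSpectrum ν q < u ↔ (lqSpectrum ν q).toReal < u := by
  conv_lhs => rw [← coe_toReal_lqSpectrum hν hq]
  exact EReal.coe_lt_coe_iff

/-- The upper quantization dimension is at most the upper Minkowski dimension. -/
lemma upperQuantDim_le_toReal_lqSpectrum_zero [IsProbabilityMeasure ν] (hν : IsCompact ν.support)
    {r : ℝ} (hr : 0 < r) : upperQuantDim ν r ≤ ((lqSpectrum ν 0).toReal : EReal) := by
  refine EReal.le_of_forall_lt_iff_le.1 fun v hv => ?_
  have hv : (lqSpectrum ν 0).toReal < v := by exact_mod_cast hv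
  have hD : 0 ≤ (lqSpectrum ν 0).toReal := EReal.toReal_nonneg (lqSpectrum_nonneg zero_le_one)
  have hv0 : 0 < v := hD.trans_lt hv
  -- The point where the line `v (1 - q)` meets `r q`; there `r q / (1 - q) = v`.
  have hq : v / (r + v) ∈ Ioo (0 : ℝ) 1 := ⟨by positivity, by rw [div_lt_one] <;> linarith⟩
  have e1 : 1 - v / (r + v) = r / (r + v) := by field_simp; ring
  have h := upperQuantDim_le hν hr hq (by
    rw [lqSpectrum_lt_iff hν (Ioo_subset_Icc_self hq)]
    refine (toReal_lqSpectrum_le hν (Ioo_subset_Icc_self hq)).trans_lt ?_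
    rw [e1, ← mul_div_assoc, ← mul_div_assoc, mul_comm r]
    gcongr)
  rw [e1] at h
  convert h using 2
  field_simp

/-- If the upper quantization dimension of some order is maximal, then the spectrum touches the
chord. -/
lemma exists_le_of_upperQuantDim_eq [IsProbabilityMeasure ν] (hν : IsCompact ν.support)
    {r D : ℝ} (hr : 0 < r) (hD : 0 < D) (hD0 : (lqSpectrum ν 0).toReal = D)
    (h : upperQuantDim ν r = (D : EReal)) :
    ∃ q ∈ Ioo (0 : ℝ) 1, D * (1 - q) ≤ (lqSpectrum ν q).toReal := by
  have hq : D / (r + D) ∈ Ioo (0 : ℝ) 1 := ⟨by positivity, by rw [div_lt_one] <;> linarith⟩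
  have e1 : D * (1 - D / (r + D)) = r * (D / (r + D)) := by field_simp; ring
  refine ⟨_, hq, ?_⟩
  by_contra! hlt
  set q₀ := D / (r + D) with hq₀
  set η := r * q₀ - (lqSpectrum ν q₀).toReal with hη
  have hη0 : 0 < η := by rw [hη]; linarith
  -- Any `s < 1` with `(1 - s) D < s η` works: convexity between `0` and `q₀` gives `β(s q₀) < r s
  -- q₀`, hence `D ≤ r s q₀ / (1 - s q₀) < r q₀ / (1 - q₀) = D`, a contradiction.
  set s := (D + η / 2) / (D + η) with hs
  have hs0 : 0 < s := by positivity
  have hs1 : s < 1 := by rw [hs, div_lt_one (by positivity)]; linarith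
  have hconv := (convexOn_lqSpectrum hν).2 (left_mem_Icc.2 zero_le_one)
    (Ioo_subset_Icc_self hq) (sub_nonneg.2 hs1.le) hs0.le (by ring)
  simp only [smul_eq_mul, mul_zero, zero_add, hD0] at hconv
  have hsη : (1 - s) * D < s * η := by
    have : s * (D + η) = D + η / 2 := div_mul_cancel₀ _ (by positivity)
    linarith
  have hq' : s * q₀ ∈ Ioo (0 : ℝ) 1 :=
    ⟨mul_pos hs0 hq.1, by nlinarith [hq.1, hq.2]⟩
  have hle := upperQuantDim_le hν hr hq' (by
    rw [lqSpectrum_lt_iff hν (Ioo_subset_Icc_self hq')]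
    refine hconv.trans_lt ?_
    rw [hη, mul_sub] at hsη
    linarith)
  rw [h, EReal.coe_le_coe_iff, le_div_iff₀ (by linarith [hq'.2])] at hle
  have hrD : 0 < r + D := by positivity
  have : q₀ * (r + D) = D := div_mul_cancel₀ _ hrD.ne'
  nlinarith

/-! ### Lower bounds for the quantization dimension -/

/-- If the spectrum touches the chord, then at infinitely many scales a non-negligible part of the
mass sits in cubes whose mass is nearly the reciprocal of their number. -/
lemma frequently_le_measure_of_chord_le [IsProbabilityMeasure ν] (hν : IsCompact ν.support)
    {D q : ℝ} (hD0 : (lqSpectrum ν 0).toReal = D) (hq : q ∈ Ioo (0 : ℝ) 1)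
    (h : D * (1 - q) ≤ (lqSpectrum ν q).toReal) {δ η : ℝ} (hδ : 0 < δ) (hη : 0 < η) :
    ∃ᶠ n : ℕ in atTop, (2 : ℝ≥0∞) ^ (-(n * η)) ≤
      ν (cubeIndex n ⁻¹' {k | ν (dyadicCube n k) ≤ 2 ^ (-(n * (D - δ)))}) := by
  obtain ⟨hq0, hq1⟩ := hq
  have hq1' : 0 < 1 - q := sub_pos.2 hq1
  -- The first bound lets `2^(n (δ (1 - q) - ε))` absorb a factor `2`; the second controls the three
  -- losses of `ε` in the final exponent.
  obtain ⟨ε, hε, hεlt⟩ : ∃ ε : ℝ, 0 < ε ∧ ε < δ * (1 - q) ∧ 3 * ε ≤ η * q := by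
    refine ⟨min (δ * (1 - q)) (η * q) / 4, by positivity, ?_, ?_⟩
    · have := min_le_left (δ * (1 - q)) (η * q)
      have : 0 < δ * (1 - q) := by positivity
      linarith
    · have := min_le_right (δ * (1 - q)) (η * q)
      have : 0 < η * q := by positivity
      linarith
  have h1 : ∃ᶠ n : ℕ in atTop, 2 ^ (n * (D * (1 - q) - ε)) < dyadicPowerSum ν n q := by
    refine frequently_lt_of_lt_growthRate ?_
    rw [← lqSpectrum_eq, ← coe_toReal_lqSpectrum hν ⟨hq0.le, hq1.le⟩, EReal.coe_lt_coe_iff]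
    linarith
  have h2 : ∀ᶠ n : ℕ in atTop, dyadicPowerSum ν n 0 ≤ 2 ^ (n * (D + ε)) := by
    refine eventually_le_of_growthRate_lt ?_
    rw [← lqSpectrum_eq, lqSpectrum_lt_iff hν ⟨le_rfl, zero_le_one⟩]
    linarith
  refine (h1.and_eventually (h2.and ((eventually_le_two_rpow (C := 2) ENNReal.ofNat_ne_top
    (sub_pos.2 hεlt.1)).and (eventually_le_two_rpow (C := 2) ENNReal.ofNat_ne_top hε)))).mono ?_
  rintro n ⟨h1, h2, h3, h4⟩
  set w : (Fin d → ℤ) → ℝ≥0∞ := fun k => ν (dyadicCube n k) with hw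
  set E : Set (Fin d → ℤ) := {k | ν (dyadicCube n k) ≤ 2 ^ (-(n * (D - δ)))} with hE
  -- Heavy cubes: `w^q = w^(-(1-q)) w`, and the total mass is at most `1`. Their share proves to be
  -- at most half of the lower bound for the power sum.
  have hbig : powerSum (Eᶜ.indicator w) q ≤ 2 ^ (n * ((D - δ) * (1 - q))) := by
    rw [powerSum_of_pos _ hq0, ← mul_one (2 ^ _), ← tsum_dyadicCube (ν := ν) n,
      ← ENNReal.tsum_mul_left]
    refine ENNReal.tsum_le_tsum fun k => ?_
    by_cases hk : k ∈ E
    · simp [hk, hq0]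
    have hk' : (2 : ℝ≥0∞) ^ (-(n * (D - δ))) < w k := not_le.1 hk
    have hk0 : w k ≠ 0 := (zero_le.trans_lt hk').ne'
    rw [indicator_of_mem (by exact hk)]
    calc w k ^ q = w k ^ (-(1 - q)) * w k := by
          nth_rw 3 [← ENNReal.rpow_one (w k)]
          rw [← ENNReal.rpow_add _ _ hk0 (measure_ne_top _ _)]
          ring_nf
      _ ≤ (2 ^ (-(n * (D - δ)))) ^ (-(1 - q)) * w k := by
          refine mul_le_mul' ?_ le_rfl
          rw [ENNReal.rpow_neg, ENNReal.rpow_neg, ENNReal.inv_le_inv]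
          gcongr
      _ = _ := by
          rw [← ENNReal.rpow_mul,
            show -(n * (D - δ)) * -(1 - q) = n * ((D - δ) * (1 - q)) by ring]
  -- Light cubes: Hölder between the exponents `0` and `1` bounds the sum by `count^(1-q) * mass^q`,
  -- so a large sum forces a large mass.
  have hsmall : powerSum (E.indicator w) q ≤
      2 ^ (n * ((D + ε) * (1 - q))) * ν (cubeIndex n ⁻¹' E) ^ q := by
    have hH := powerSum_le_mul (E.indicator w)
      (fun k => (lt_of_le_of_lt (indicator_le_self' (fun _ _ => zero_le) k) (measure_lt_top _ _)).ne)
      hq0.le hq1.le 0 1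
    rw [mul_zero, zero_add, mul_one, powerSum_one, tsum_indicator_dyadicCube] at hH
    refine hH.trans ?_
    gcongr
    calc powerSum (E.indicator w) 0 ^ (1 - q) ≤ (2 ^ (n * (D + ε))) ^ (1 - q) := by
          gcongr
          exact (powerSum_indicator_le w E 0).trans h2
      _ = _ := by rw [← ENNReal.rpow_mul]; ring_nf
  have hdouble : 2 * powerSum (Eᶜ.indicator w) q ≤ 2 ^ (n * (D * (1 - q) - ε)) := by
    calc 2 * powerSum (Eᶜ.indicator w) q
        ≤ 2 ^ (n * (δ * (1 - q) - ε)) * 2 ^ (n * ((D - δ) * (1 - q))) := by gcongr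
      _ = _ := by rw [← two_rpow_add]; ring_nf
  have hmain : (2 : ℝ≥0∞) ^ (n * (D * (1 - q) - ε)) ≤ 2 * powerSum (E.indicator w) q := by
    have hsum := (h1.le.trans (powerSum_le_add_compl w E q))
    refine ENNReal.le_of_add_le_add_right (a := 2 ^ (n * (D * (1 - q) - ε))) (two_rpow_ne_top _) ?_
    calc (2 : ℝ≥0∞) ^ (n * (D * (1 - q) - ε)) + 2 ^ (n * (D * (1 - q) - ε))
        = 2 * 2 ^ (n * (D * (1 - q) - ε)) := (two_mul _).symm
      _ ≤ 2 * (powerSum (E.indicator w) q + powerSum (Eᶜ.indicator w) q) := by gcongr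
      _ ≤ _ := by rw [mul_add]; gcongr
  rw [← ENNReal.rpow_le_rpow_iff hq0, ← ENNReal.rpow_mul]
  calc (2 : ℝ≥0∞) ^ (-(n * η) * q)
      ≤ 2 ^ (n * (D * (1 - q) - ε) - n * (ε + (D + ε) * (1 - q))) := by
        refine two_rpow_le_two_rpow ?_
        have hn : (0 : ℝ) ≤ n := Nat.cast_nonneg n
        have : 0 ≤ ε * q := by positivity
        have : (0 : ℝ) ≤ n * (η * q - 3 * ε + ε * q) := mul_nonneg hn (by linarith)
        linarith
    _ = 2 ^ (n * (D * (1 - q) - ε)) * 2 ^ (-(n * (ε + (D + ε) * (1 - q)))) := by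
        rw [sub_eq_add_neg, two_rpow_add]
    _ ≤ (2 ^ (n * ε) * (2 ^ (n * ((D + ε) * (1 - q))) * ν (cubeIndex n ⁻¹' E) ^ q)) *
          2 ^ (-(n * (ε + (D + ε) * (1 - q)))) := by
        gcongr
        exact hmain.trans (by gcongr)
    _ = (2 ^ (n * ε) * 2 ^ (n * ((D + ε) * (1 - q))) *
          2 ^ (-(n * (ε + (D + ε) * (1 - q))))) * ν (cubeIndex n ⁻¹' E) ^ q := by ring
    _ = ν (cubeIndex n ⁻¹' E) ^ q := by
        rw [← two_rpow_add, ← two_rpow_add]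
        ring_nf
        simp

/-- A codebook with few points cannot approximate well a measure with much mass in small cubes. -/
lemma le_quantError_of_small_cubes [IsProbabilityMeasure ν] {r : ℝ} (hr : 0 < r) {n m : ℕ}
    {E : Set (Fin d → ℤ)} {τ a : ℝ≥0∞} (hE : ∀ k ∈ E, ν (dyadicCube n k) ≤ τ)
    (ha : a ≤ ν (cubeIndex n ⁻¹' E)) (hm : 2 * (m * (3 ^ d * τ)) ≤ a) :
    (2⁻¹ * a * 2 ^ (-(n * r))) ^ (1 / r) ≤ quantError ν m r := by
  classical
  refine le_iInf₂ fun f ⟨hf, hcard⟩ => ENNReal.rpow_le_rpow ?_ (by positivity)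
  have hfin : (range f).Finite := encard_ne_top_iff.1 (hcard.trans_lt (by simp)).ne
  have hcard' : hfin.toFinset.card ≤ m := by
    rw [hfin.encard_eq_coe_toFinset_card] at hcard
    exact_mod_cast hcard
  -- `B` collects the points with error at least `2⁻ⁿ`. Any other point lies in a cube adjacent to
  -- that of its code point, and the relevant `m * 3 ^ d` cubes carry at most half of `a`.
  set B : Set (EuclideanSpace ℝ (Fin d)) := {x | (2 : ℝ≥0∞) ^ (-(n * r)) ≤ ‖x - f x‖ₑ ^ r}
  have hsub : cubeIndex n ⁻¹' E ⊆
      (⋃ c ∈ hfin.toFinset, ⋃ k ∈ (neighbours (cubeIndex n c)).filter (· ∈ E), dyadicCube n k) ∪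
        B := by
    intro x hx
    by_cases hB : x ∈ B
    · exact Or.inr hB
    left
    have hlt : ‖x - f x‖ₑ ^ r < (2 : ℝ≥0∞) ^ (-(n * r)) := not_le.1 hB
    rw [← neg_mul, ENNReal.rpow_mul, ENNReal.rpow_lt_rpow_iff hr, ← edist_eq_enorm_sub] at hlt
    refine mem_biUnion (x := f x) (by simp) (mem_biUnion (x := cubeIndex n x) ?_
      (mem_dyadicCube_cubeIndex n x))
    simp only [Finset.coe_filter, mem_ofPred_eq]
    exact ⟨cubeIndex_mem_neighbours hlt.le, hx⟩
  have h1 : ν (⋃ c ∈ hfin.toFinset, ⋃ k ∈ (neighbours (cubeIndex n c)).filter (· ∈ E),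
      dyadicCube n k) ≤ m * (3 ^ d * τ) := by
    have hc (c) : ν (⋃ k ∈ (neighbours (cubeIndex n c)).filter (· ∈ E), dyadicCube n k) ≤
        3 ^ d * τ := by
      refine (measure_biUnion_finset_le _ _).trans ((Finset.sum_le_card_nsmul _ _ τ
        fun k hk => hE k (Finset.mem_filter.1 hk).2).trans ?_)
      rw [nsmul_eq_mul]
      gcongr
      exact_mod_cast (Finset.card_filter_le _ _).trans (card_neighbours _).le
    refine (measure_biUnion_finset_le _ _).trans ((Finset.sum_le_card_nsmul _ _ _
      fun c _ => hc c).trans ?_)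
    rw [nsmul_eq_mul]
    gcongr
  have h2 : (2 : ℝ≥0∞) ^ (-(n * r)) * ν B ≤ ∫⁻ x, ‖x - f x‖ₑ ^ r ∂ν :=
    mul_meas_ge_le_lintegral (by fun_prop) _
  have hle : a ≤ m * (3 ^ d * τ) + ν B :=
    ha.trans ((measure_mono hsub).trans ((measure_union_le _ _).trans (by gcongr)))
  have hane : a ≠ ⊤ := (ha.trans_lt (measure_lt_top _ _)).ne
  have hB : a ≤ 2 * ν B := by
    refine ENNReal.le_of_add_le_add_right (a := a) hane ?_
    calc a + a = 2 * a := (two_mul _).symm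
      _ ≤ 2 * (m * (3 ^ d * τ) + ν B) := by gcongr
      _ ≤ 2 * ν B + a := by rw [mul_add, add_comm]; gcongr
  calc 2⁻¹ * a * 2 ^ (-(n * r)) ≤ 2⁻¹ * (2 * ν B) * 2 ^ (-(n * r)) := by gcongr
    _ = 2 ^ (-(n * r)) * ν B := by
        rw [← mul_assoc, ENNReal.inv_mul_cancel two_ne_zero ENNReal.ofNat_ne_top, one_mul, mul_comm]
    _ ≤ _ := h2

/-- The hypothesis `e < 1` makes the denominator positive, and the lower bound on `e` keeps it
finite. -/
lemma le_log_div_neg_log {m : ℕ} (hm : 0 < m) {e : ℝ≥0∞} (he : e < 1) {u : ℝ} (hu : 0 < u)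
    (h : (m : ℝ≥0∞) ^ (-u⁻¹) ≤ e) :
    (u : EReal) ≤ ((Real.log m : ℝ) : EReal) / (-ENNReal.log e) := by
  have hm0 : (m : ℝ≥0∞) ≠ 0 := by exact_mod_cast hm.ne'
  have h1 := ENNReal.log_le_log h
  have h2 := ENNReal.log_lt_zero_iff.2 he
  rw [ENNReal.log_rpow, ENNReal.log_pos_real hm0 (ENNReal.natCast_ne_top m), ENNReal.toReal_natCast,
    ← EReal.coe_mul] at h1
  induction hb : ENNReal.log e with
  | bot =>
    rw [hb] at h1
    exact absurd (le_bot_iff.1 h1) (EReal.coe_ne_bot _)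
  | top => simp [hb] at h2
  | coe b =>
    rw [hb, EReal.coe_le_coe_iff] at h1
    rw [hb] at h2
    have hb0 : 0 < -b := by
      have : b < 0 := by exact_mod_cast h2
      linarith
    rw [← EReal.coe_neg, ← EReal.coe_div, EReal.coe_le_coe_iff, le_div_iff₀ hb0]
    have h3 : -b ≤ u⁻¹ * Real.log m := by linarith
    calc u * -b ≤ u * (u⁻¹ * Real.log m) := by gcongr
      _ = Real.log m := by field_simp

/-- If the spectrum touches the chord, then the upper quantization dimension of every order is at
least the upper Minkowski dimension. -/
lemma le_upperQuantDim_of_chord_le [IsProbabilityMeasure ν] (hν : IsCompact ν.support)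
    {D q r : ℝ} (hr : 0 < r) (hD : 0 < D) (hD0 : (lqSpectrum ν 0).toReal = D)
    (hq : q ∈ Ioo (0 : ℝ) 1) (h : D * (1 - q) ≤ (lqSpectrum ν q).toReal) :
    (D : EReal) ≤ upperQuantDim ν r := by
  have hsmall : ∀ᶠ m : ℕ in atTop, quantError ν m r < 1 := by
    have hv : 0 < D + 1 := by linarith
    -- The crossing point for `D + 1` in place of `D`: there the chord is strictly below `r q`, so
    -- the error tends to `0` and its logarithm has the right sign.
    have hq' : (D + 1) / (r + (D + 1)) ∈ Ioo (0 : ℝ) 1 :=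
      ⟨by positivity, by rw [div_lt_one] <;> linarith⟩
    have e1 : 1 - (D + 1) / (r + (D + 1)) = r / (r + (D + 1)) := by field_simp; ring
    have hlt : lqSpectrum ν ((D + 1) / (r + (D + 1))) <
        ((r * ((D + 1) / (r + (D + 1))) : ℝ) : EReal) := by
      rw [lqSpectrum_lt_iff hν (Ioo_subset_Icc_self hq')]
      refine (toReal_lqSpectrum_le hν (Ioo_subset_Icc_self hq')).trans_lt ?_
      rw [e1, hD0, ← mul_div_assoc, ← mul_div_assoc, mul_comm r]
      gcongr
      linarith
    have hκ : 0 < (1 - (D + 1) / (r + (D + 1))) / (r * ((D + 1) / (r + (D + 1)))) :=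
      div_pos (sub_pos.2 hq'.2) (mul_pos hr hq'.1)
    obtain ⟨κ, hκ0, hκ1⟩ := exists_between hκ
    filter_upwards [eventually_quantError_le hν hr hq'.1 hlt hκ1, eventually_ge_atTop 2]
      with m h1 h2
    refine h1.trans_lt (ENNReal.rpow_lt_one_of_one_lt_of_neg ?_ (by linarith))
    exact_mod_cast h2
  refine le_of_forall_lt_imp_le_of_dense fun y hy => ?_
  obtain ⟨u, hu0, huD, hyu⟩ : ∃ u : ℝ, 0 < u ∧ u < D ∧ y ≤ u := by
    obtain ⟨u, hu, huD⟩ := EReal.lt_iff_exists_real_btwn.1 (max_lt hy (EReal.coe_pos.2 hD))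
    exact ⟨u, EReal.coe_pos.1 ((le_max_right _ _).trans_lt hu), EReal.coe_lt_coe_iff.1 huD,
      ((le_max_left _ _).trans_lt hu).le⟩
  refine hyu.trans ?_
  -- Codebooks of size `m ≈ 2^(n w)` are used. The choice of `w` gives `2^(-n w / u) = 2^(-n) 2^(-2
  -- n η / r)`, which pays for the mass `2^(-n η)` and for a factor `1/2`. The choice of `η` leaves
  -- the gap `D - 2η - w = 2η (1 + u / r) > 0`.
  set η := (D - u) / (4 * (1 + u / r)) with hη
  have hη0 : 0 < η := div_pos (sub_pos.2 huD) (by positivity)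
  set w := u * (1 + 2 * η / r) with hw
  have hw0 : 0 < w := by positivity
  have hgap : 0 < D - 2 * η - w := by
    have e : 4 * η * (1 + u / r) = D - u := by rw [hη]; field_simp
    have e2 : w = u + 2 * η * (u / r) := by rw [hw]; field_simp
    have : 0 < η * (u / r) := by positivity
    rw [e2]
    linarith
  have ht : Tendsto (fun n : ℕ => ⌈(2 : ℝ) ^ (n * w)⌉₊) atTop atTop := by
    refine tendsto_nat_ceil_atTop.comp ?_
    have := tendsto_pow_atTop_atTop_of_one_lt (Real.one_lt_rpow (by norm_num : (1 : ℝ) < 2) hw0)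
    refine this.congr fun n => ?_
    rw [mul_comm (n : ℝ), Real.rpow_mul (by norm_num) w, Real.rpow_natCast]
  refine le_limsup_of_frequently_le (ht.frequently ?_) (by isBoundedDefault)
  have hC : (4 * 3 ^ d : ℝ≥0∞) ≠ ⊤ := ENNReal.mul_ne_top (by simp) (by simp)
  refine ((frequently_le_measure_of_chord_le hν hD0 hq h hη0 hη0).and_eventually
    ((eventually_le_two_rpow hC hgap).and ((eventually_le_two_rpow (C := 2) ENNReal.ofNat_ne_top
      hη0).and (ht.eventually hsmall)))).mono ?_
  rintro n ⟨h1, h2, h3, h4⟩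
  set m := ⌈(2 : ℝ) ^ (n * w)⌉₊ with hm
  have hpos : (0 : ℝ) < 2 ^ (n * w) := by positivity
  have e2 : (2 : ℝ≥0∞) ^ (n * w) = ENNReal.ofReal ((2 : ℝ) ^ (n * w)) := by
    rw [← ENNReal.ofReal_rpow_of_pos (by norm_num)]; norm_num
  have hm1 : (2 : ℝ≥0∞) ^ (n * w) ≤ m := by
    rw [e2, ← ENNReal.ofReal_natCast]
    exact ENNReal.ofReal_le_ofReal (Nat.le_ceil _)
  have hm2 : (m : ℝ≥0∞) ≤ 2 * 2 ^ (n * w) := by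
    have h1le : (1 : ℝ) ≤ 2 ^ (n * w) := Real.one_le_rpow (by norm_num) (by positivity)
    rw [e2, ← ENNReal.ofReal_natCast, ← ENNReal.ofReal_ofNat 2, ← ENNReal.ofReal_mul (by norm_num)]
    refine ENNReal.ofReal_le_ofReal ?_
    linarith [(Nat.ceil_lt_add_one hpos.le).le]
  have hm0 : 0 < m := Nat.ceil_pos.2 hpos
  refine le_log_div_neg_log hm0 h4 hu0 ?_
  have hcount : 2 * (m * (3 ^ d * (2 : ℝ≥0∞) ^ (-(n * (D - η))))) ≤ 2 ^ (-(n * η)) := by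
    calc 2 * (m * (3 ^ d * (2 : ℝ≥0∞) ^ (-(n * (D - η)))))
        ≤ 2 * ((2 * 2 ^ (n * w)) * (3 ^ d * (2 : ℝ≥0∞) ^ (-(n * (D - η))))) := by gcongr
      _ = (4 * 3 ^ d) * (2 ^ (n * w) * 2 ^ (-(n * (D - η)))) := by ring
      _ ≤ 2 ^ (n * (D - 2 * η - w)) * (2 ^ (n * w) * 2 ^ (-(n * (D - η)))) := by gcongr
      _ = _ := by rw [← two_rpow_add, ← two_rpow_add]; ring_nf
  refine le_trans ?_ (le_quantError_of_small_cubes hr (fun k hk => hk) h1 hcount)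
  have hhalf : (2 : ℝ≥0∞) ^ (-(n * η)) ≤ 2⁻¹ := by
    rw [ENNReal.rpow_neg]; exact ENNReal.inv_le_inv.2 h3
  calc (m : ℝ≥0∞) ^ (-u⁻¹) ≤ (2 ^ (n * w)) ^ (-u⁻¹) := by
        rw [ENNReal.rpow_neg, ENNReal.rpow_neg, ENNReal.inv_le_inv]
        gcongr
    _ = (2 ^ (-(n * η)) * 2 ^ (-(n * η)) * 2 ^ (-(n * r))) ^ (1 / r) := by
        rw [← two_rpow_add, ← two_rpow_add, ← ENNReal.rpow_mul, ← ENNReal.rpow_mul]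
        congr 1
        rw [hw]
        field_simp
        ring
    _ ≤ _ := by gcongr

/-! ### Dimensions of the measure -/

/-- If the spectrum lies below `s (1 - q)` for some `q`, then the upper local dimension is almost
everywhere at most `s`. -/
lemma ae_eventually_le_measure_dyadicCube [IsProbabilityMeasure ν]
    {q s : ℝ} (hq : q ∈ Ioo (0 : ℝ) 1) (h : lqSpectrum ν q < ((s * (1 - q) : ℝ) : EReal)) :
    ∀ᵐ x ∂ν, ∀ᶠ n : ℕ in atTop, (2 : ℝ≥0∞) ^ (-(n * s)) ≤ ν (dyadicCube n (cubeIndex n x)) := by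
  have hq1 : 0 < 1 - q := sub_pos.2 hq.2
  let E (n : ℕ) : Set (Fin d → ℤ) := {k | ν (dyadicCube n k) < 2 ^ (-(n * s))}
  -- On light cubes `ν(C) = ν(C)^q ν(C)^(1-q)` with the last factor at most `2^(-n s (1-q))`; the
  -- resulting series converges, so Borel–Cantelli applies.
  have hbound (n : ℕ) : ν (cubeIndex n ⁻¹' E n) ≤ dyadicPowerSum ν n q * 2 ^ (-(n * (s * (1 - q)))) := by
    rw [← tsum_indicator_dyadicCube, dyadicPowerSum_eq, powerSum_of_pos _ hq.1,
      ← ENNReal.tsum_mul_right]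
    refine ENNReal.tsum_le_tsum fun k => ?_
    by_cases hk : k ∈ E n
    swap
    · simp [hk]
    rw [indicator_of_mem hk]
    have hk : ν (dyadicCube n k) < 2 ^ (-(n * s)) := hk
    calc ν (dyadicCube n k) = ν (dyadicCube n k) ^ q * ν (dyadicCube n k) ^ (1 - q) := by
          rw [← ENNReal.rpow_add_of_nonneg _ _ hq.1.le hq1.le, add_sub_cancel, ENNReal.rpow_one]
      _ ≤ ν (dyadicCube n k) ^ q * (2 ^ (-(n * s))) ^ (1 - q) := by gcongr
      _ = _ := by rw [← ENNReal.rpow_mul]; ring_nf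
  obtain ⟨u, hu, hus⟩ := EReal.lt_iff_exists_real_btwn.1 h
  have hus : u < s * (1 - q) := by exact_mod_cast hus
  have hsum : ∑' n, ν (cubeIndex n ⁻¹' E n) ≠ ⊤ := by
    refine tsum_ne_top_of_eventually_le (fun n => measure_ne_top _ _) (sub_pos.2 hus) ?_
    filter_upwards [eventually_le_of_growthRate_lt hu] with n hn
    calc ν (cubeIndex n ⁻¹' E n) ≤ dyadicPowerSum ν n q * 2 ^ (-(n * (s * (1 - q)))) := hbound n
      _ ≤ 2 ^ (n * u) * 2 ^ (-(n * (s * (1 - q)))) := by gcongr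
      _ = _ := by rw [← two_rpow_add]; ring_nf
  filter_upwards [ae_eventually_notMem hsum] with x hx
  filter_upwards [hx] with n hn
  exact not_lt.1 hn

/-- The points whose dyadic cubes of level at least `j` have mass at least `2 ^ (-n s)`. -/
def heavyPoints (ν : Measure (EuclideanSpace ℝ (Fin d))) (s : ℝ) (j : ℕ) :
    Set (EuclideanSpace ℝ (Fin d)) :=
  {x | ∀ n ≥ j, (2 : ℝ≥0∞) ^ (-(n * s)) ≤ ν (dyadicCube n (cubeIndex n x))}

lemma measurableSet_heavyPoints (s : ℝ) (j : ℕ) : MeasurableSet (heavyPoints ν s j) := by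
  have e : heavyPoints ν s j = ⋂ n ≥ j,
      cubeIndex n ⁻¹' {k | (2 : ℝ≥0∞) ^ (-(n * s)) ≤ ν (dyadicCube n k)} := by
    ext x; simp [heavyPoints]
  rw [e]
  exact MeasurableSet.biInter (to_countable _) fun n _ =>
    measurable_cubeIndex n MeasurableSet.of_discrete

/-- Markov's inequality for the masses of a level, whose sum is `1`. -/
lemma exists_finite_heavyCubes [IsProbabilityMeasure ν] (n : ℕ) (s : ℝ) :
    ∃ hf : {k : Fin d → ℤ | (2 : ℝ≥0∞) ^ (-(n * s)) ≤ ν (dyadicCube n k)}.Finite,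
      (hf.toFinset.card : ℝ≥0∞) ≤ 2 ^ (n * s) := by
  obtain ⟨hf, hc⟩ := ENNReal.finset_card_const_le_le_of_tsum_le ENNReal.one_ne_top
    (tsum_dyadicCube (ν := ν) n).le (two_rpow_ne_zero (-(n * s)))
  refine ⟨hf, hc.trans (le_of_eq ?_)⟩
  rw [ENNReal.rpow_neg, one_div, inv_inv]

lemma upperMinkowskiDim_heavyPoints_le [IsProbabilityMeasure ν] {s : ℝ} (hs : 0 ≤ s) (j : ℕ) :
    upperMinkowskiDim (heavyPoints ν s j) ≤ s := by
  refine upperMinkowskiDim_le (A := ((d + 1 : ℕ) : ℝ≥0)) (by positivity) ENNReal.one_ne_top hs ?_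
  filter_upwards [eventually_ge_atTop j] with n hn
  obtain ⟨hf, hc⟩ := exists_finite_heavyCubes (ν := ν) n s
  have := externalCoveringNumber_le_encard (S := heavyPoints ν s j) n
    (E := {k : Fin d → ℤ | (2 : ℝ≥0∞) ^ (-(n * s)) ≤ ν (dyadicCube n k)})
    fun x hx => ⟨x, by simp, hx n hn⟩
  rw [hf.encard_eq_coe_toFinset_card] at this
  rw [one_mul]
  refine le_trans ?_ hc
  exact_mod_cast this

/-- Covering by at most `2^(n s)` cubes of diameter at most `d 2^(-n)` bounds the `s`-dimensional
Hausdorff measure by `d ^ s`. -/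
lemma dimH_heavyPoints_le [IsProbabilityMeasure ν] {s : ℝ≥0} (j : ℕ) :
    dimH (heavyPoints ν s j) ≤ s := by
  refine dimH_le_of_hausdorffMeasure_ne_top ?_
  let H (n : ℕ) : Set (Fin d → ℤ) := {k | (2 : ℝ≥0∞) ^ (-(n * (s : ℝ))) ≤ ν (dyadicCube n k)}
  have hH (n) := exists_finite_heavyCubes (ν := ν) n s
  have hdiam (n : ℕ) (k : Fin d → ℤ) :
      Metric.ediam (dyadicCube n k : Set (EuclideanSpace ℝ (Fin d))) ≤
        d * (2 : ℝ≥0∞) ^ (-(n : ℝ)) :=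
    Metric.ediam_le fun x hx y hy => edist_le_of_mem_dyadicCube hx hy
  have ht : Tendsto (fun n : ℕ => (d : ℝ≥0∞) * (2 : ℝ≥0∞) ^ (-(n : ℝ))) atTop (𝓝 0) := by
    have h1 : Tendsto (fun n : ℕ => ((2 : ℝ≥0∞)⁻¹) ^ n) atTop (𝓝 0) :=
      ENNReal.tendsto_pow_atTop_nhds_zero_of_lt_one (by simp)
    have h2 := ENNReal.Tendsto.const_mul (a := (d : ℝ≥0∞)) h1 (Or.inr (by simp))
    rw [mul_zero] at h2
    refine h2.congr fun n => ?_
    rw [ENNReal.rpow_neg, ENNReal.rpow_natCast, ENNReal.inv_pow]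
  have h := Measure.hausdorffMeasure_le_liminf_tsum (s : ℝ) (heavyPoints ν s j)
    (l := atTop) _ ht (fun n (k : H n) => dyadicCube n k)
    (Eventually.of_forall fun n k => hdiam n k) (by
      filter_upwards [eventually_ge_atTop j] with n hn x hx
      exact mem_iUnion.2 ⟨⟨cubeIndex n x, hx n hn⟩, mem_dyadicCube_cubeIndex n x⟩)
  suffices hle : ∀ n : ℕ, ∑' k : H n, Metric.ediam
      (dyadicCube n (k : Fin d → ℤ) : Set (EuclideanSpace ℝ (Fin d))) ^ (s : ℝ) ≤
        (d : ℝ≥0∞) ^ (s : ℝ) from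
    ((h.trans (liminf_le_of_frequently_le' (Frequently.of_forall hle))).trans_lt
      (ENNReal.rpow_lt_top_of_nonneg s.coe_nonneg (by simp))).ne
  intro n
  obtain ⟨hf, hc⟩ := hH n
  calc ∑' k : H n, Metric.ediam (dyadicCube n (k : Fin d → ℤ) : Set (EuclideanSpace ℝ (Fin d))) ^ (s : ℝ)
      ≤ ∑' _ : H n, (d * (2 : ℝ≥0∞) ^ (-(n : ℝ))) ^ (s : ℝ) :=
        ENNReal.tsum_le_tsum fun k => by gcongr; exact hdiam n k
    _ = ((H n).encard : ℝ≥0∞) * (d * (2 : ℝ≥0∞) ^ (-(n : ℝ))) ^ (s : ℝ) := by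
        rw [ENNReal.tsum_set_const]
    _ ≤ 2 ^ (n * (s : ℝ)) * (d * (2 : ℝ≥0∞) ^ (-(n : ℝ))) ^ (s : ℝ) := by
        gcongr
        rw [Finite.encard_eq_coe_toFinset_card hf]
        exact_mod_cast hc
    _ = (d : ℝ≥0∞) ^ (s : ℝ) * (2 ^ (n * (s : ℝ)) * 2 ^ (-(n : ℝ) * s)) := by
        rw [ENNReal.mul_rpow_of_nonneg _ _ s.coe_nonneg, ← ENNReal.rpow_mul]; ring
    _ = (d : ℝ≥0∞) ^ (s : ℝ) := by rw [← two_rpow_add]; simp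

lemma measure_iUnion_heavyPoints [IsProbabilityMeasure ν]
    {q s : ℝ} (hq : q ∈ Ioo (0 : ℝ) 1) (h : lqSpectrum ν q < ((s * (1 - q) : ℝ) : EReal)) :
    ν (⋃ j, heavyPoints ν s j) = 1 := by
  rw [← measure_univ (μ := ν)]
  refine measure_congr (eventuallyEq_univ.2 ?_)
  filter_upwards [ae_eventually_le_measure_dyadicCube hq h] with x hx
  obtain ⟨j, hj⟩ := eventually_atTop.1 hx
  exact mem_iUnion.2 ⟨j, hj⟩

/-- The union of the sets `heavyPoints ν s j` has full measure, and the sets themselves form the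
countable cover in the definition of packing dimension. -/
lemma packingDimStarMeasure_le [IsProbabilityMeasure ν]
    {q s : ℝ} (hq : q ∈ Ioo (0 : ℝ) 1) (hs : 0 ≤ s)
    (h : lqSpectrum ν q < ((s * (1 - q) : ℝ) : EReal)) : packingDimStarMeasure ν ≤ s := by
  have hfull : ν (⋃ j, heavyPoints ν s j) = ν univ := by
    rw [measure_iUnion_heavyPoints hq h, measure_univ]
  refine (iInf₂_le (⋃ j, heavyPoints ν s j) ⟨MeasurableSet.iUnion fun j =>
    measurableSet_heavyPoints s j, hfull⟩).trans ?_
  exact (iInf₂_le (heavyPoints ν s) Subset.rfl).trans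
    (iSup_le fun j => upperMinkowskiDim_heavyPoints_le hs j)

lemma hausdorffDimMeasure_le [IsProbabilityMeasure ν]
    {q s : ℝ} (hq : q ∈ Ioo (0 : ℝ) 1) (hs : 0 ≤ s)
    (h : lqSpectrum ν q < ((s * (1 - q) : ℝ) : EReal)) : hausdorffDimMeasure ν ≤ s := by
  have hu := measure_iUnion_heavyPoints hq h
  obtain ⟨j, hj⟩ : ∃ j, 0 < ν (heavyPoints ν s j) := by
    by_contra! hno
    rw [measure_iUnion_null fun j => nonpos_iff_eq_zero.1 (hno j)] at hu
    exact zero_ne_one hu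
  refine (iInf₂_le (heavyPoints ν s j) ⟨measurableSet_heavyPoints s j, hj⟩).trans ?_
  lift s to ℝ≥0 using hs
  exact EReal.coe_ennreal_le_coe_ennreal_iff.2 (dimH_heavyPoints_le j)

/-- If the packing or Hausdorff dimension of the measure equals the upper Minkowski dimension of
its support, then the spectrum lies above the chord. -/
lemma chord_le_of_dim_eq [IsProbabilityMeasure ν] (hν : IsCompact ν.support) {D q : ℝ}
    (hq : q ∈ Ioo (0 : ℝ) 1)
    (h : packingDimStarMeasure ν = (D : EReal) ∨ hausdorffDimMeasure ν = (D : EReal)) :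
    D * (1 - q) ≤ (lqSpectrum ν q).toReal := by
  by_contra! hlt
  have hq1 : 0 < 1 - q := sub_pos.2 hq.2
  -- `s` lies strictly between `β(q) / (1 - q)` and `D`, so a dimension bound by `s` is a
  -- contradiction.
  obtain ⟨s, hs1, hs2⟩ := exists_between ((div_lt_iff₀ hq1).2 hlt)
  have hs0 : 0 ≤ s := (div_nonneg (EReal.toReal_nonneg (lqSpectrum_nonneg hq.2.le)) hq1.le).trans
    hs1.le
  have hβ : lqSpectrum ν q < ((s * (1 - q) : ℝ) : EReal) := by
    rw [lqSpectrum_lt_iff hν (Ioo_subset_Icc_self hq)]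
    exact (div_lt_iff₀ hq1).1 hs1
  rcases h with h | h
  · have := packingDimStarMeasure_le hq hs0 hβ
    rw [h, EReal.coe_le_coe_iff] at this
    linarith
  · have := hausdorffDimMeasure_le hq hs0 hβ
    rw [h, EReal.coe_le_coe_iff] at this
    linarith

end QuantDim

theorem corollary1p7 (d : ℕ) (ν : MeasureTheory.Measure (EuclideanSpace ℝ (Fin d)))
    [MeasureTheory.IsProbabilityMeasure ν] (hν : IsCompact ν.support)
    (hdim : 0 < QuantDim.upperMinkowskiDimMeasure ν) :
    List.TFAE
      [ ∃ r : ℝ, 0 < r ∧ QuantDim.upperQuantDim ν r = QuantDim.upperMinkowskiDimMeasure ν,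
        ∃ q : ℝ, q ∈ Set.Ioo (0 : ℝ) 1 ∧
          QuantDim.upperRenyiDim ν q = QuantDim.upperMinkowskiDimMeasure ν,
        QuantDim.LeftDerivAtOneLE ν (-QuantDim.upperMinkowskiDimMeasure ν),
        ∀ q ∈ Set.Icc (0 : ℝ) 1, QuantDim.lqSpectrum ν q =
          QuantDim.upperMinkowskiDimMeasure ν * ((1 - q : ℝ) : EReal),
        ∀ r : ℝ, 0 < r → QuantDim.upperQuantDim ν r = QuantDim.upperMinkowskiDimMeasure ν ] ∧
    ((QuantDim.packingDimStarMeasure ν = QuantDim.upperMinkowskiDimMeasure ν ∨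
        QuantDim.hausdorffDimMeasure ν = QuantDim.upperMinkowskiDimMeasure ν) →
      QuantDim.LeftDerivAtOneLE ν (-QuantDim.upperMinkowskiDimMeasure ν)) := by
  open QuantDim in
  obtain ⟨D, hD⟩ : ∃ D : ℝ, upperMinkowskiDimMeasure ν = D :=
    ⟨_, by rw [← lqSpectrum_zero, coe_toReal_lqSpectrum hν (left_mem_Icc.2 zero_le_one)]⟩
  have hD0 : (lqSpectrum ν 0).toReal = D := by rw [lqSpectrum_zero, hD, EReal.toReal_coe]
  rw [hD] at hdim ⊢
  have hDpos : 0 < D := EReal.coe_pos.1 hdim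
  have hconv := convexOn_lqSpectrum hν
  -- The hub of the equivalence: touching the chord at one interior point yields linearity.
  have chord {q : ℝ} (hq : q ∈ Ioo (0 : ℝ) 1) (h : D * (1 - q) ≤ (lqSpectrum ν q).toReal) :
      ∀ p ∈ Icc (0 : ℝ) 1, (lqSpectrum ν p).toReal = D * (1 - p) := fun p hp => by
    rw [← hD0] at h ⊢
    exact eq_chord_of_convexOn hconv toReal_lqSpectrum_one hq h hp
  have half : (1 / 2 : ℝ) ∈ Ioo (0 : ℝ) 1 := by constructor <;> norm_num
  refine ⟨?_, fun h => ?_⟩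
  · tfae_have 1 → 4 := by
      rintro ⟨r, hr, h⟩ p hp
      obtain ⟨q, hq, hle⟩ := exists_le_of_upperQuantDim_eq hν hr hDpos hD0 h
      rw [← coe_toReal_lqSpectrum hν hp, chord hq hle p hp, EReal.coe_mul]
    tfae_have 4 → 5 := by
      intro h r hr
      have hr' := h _ (Ioo_subset_Icc_self half)
      refine le_antisymm (hD0 ▸ upperQuantDim_le_toReal_lqSpectrum_zero hν hr) ?_
      refine le_upperQuantDim_of_chord_le hν hr hDpos hD0 half ?_
      rw [hr', ← EReal.coe_mul, EReal.toReal_coe]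
    tfae_have 5 → 1 := fun h => ⟨1, one_pos, h 1 one_pos⟩
    tfae_have 4 → 2 := by
      intro h
      refine ⟨_, half, ?_⟩
      rw [upperRenyiDim, if_neg half.2.ne, h _ (Ioo_subset_Icc_self half), ← EReal.coe_mul,
        ← EReal.coe_div, mul_div_cancel_right₀ _ (sub_pos.2 half.2).ne']
    tfae_have 2 → 4 := by
      rintro ⟨q, hq, h⟩ p hp
      have hq1 : 0 < 1 - q := sub_pos.2 hq.2
      rw [upperRenyiDim, if_neg hq.2.ne, ← coe_toReal_lqSpectrum hν (Ioo_subset_Icc_self hq),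
        ← EReal.coe_div, EReal.coe_eq_coe_iff, div_eq_iff hq1.ne'] at h
      rw [← coe_toReal_lqSpectrum hν hp, chord hq h.ge p hp, EReal.coe_mul]
    tfae_have 4 → 3 := by
      intro h
      rw [← EReal.coe_neg]
      refine leftDerivAtOneLE_of_eqOn fun q hq => ?_
      rw [h q hq, ← EReal.coe_mul, EReal.toReal_coe]
    tfae_have 3 → 4 := by
      rintro ⟨b, hb, hbD⟩ p hp
      rw [← EReal.coe_neg, EReal.coe_le_coe_iff] at hbD
      have hle := chord_le_of_hasDerivWithinAt hconv toReal_lqSpectrum_one hb (hD0 ▸ hbD) half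
      rw [← coe_toReal_lqSpectrum hν hp, chord half (hD0 ▸ hle) p hp, EReal.coe_mul]
    tfae_finish
  · rw [← EReal.coe_neg]
    exact leftDerivAtOneLE_of_eqOn (chord half (chord_le_of_dim_eq hν half h))
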